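/- Let $G$ be a set and $\alpha_G\colon G\to\mathbb N$ a function. A word is a finite, possibly empty, sequence of positive integers; $e$ is the empty word, and $ab$ is concatenation. For a word $a$ and a set $M$ of words let $a\cdot M=\{ab\mid b\in M\}$. For $n\neq 1$ let $\hat n=\{1,\dots,n\}$ (a set of one-letter words), and let $\hat 1=\{e\}$. **Terms.** The $e$-terms $f$, with sets of words $s(f)$, are given inductively: each $x\in G$ is a term, $s(x)=\widehat{\alpha_G(x)}$; $I$ is a term, $s(I)=\{e\}$; if $f,g$ are terms and $a\in s(g)$, then $g\triangleleft_a f$ is a term, $s(g\triangleleft_a f)=(s(g)\setminus\{a\})\cup a\cdot s(f)$. The $u$-terms $f$, with sets of words $s(f)$ and words $t(f)$, are given inductively: for every word $a$ and $x\in G$, $a\cdot x$ is a term, $s(a\cdot x)=a\cdot\widehat{\alpha_G(x)}$, $t(a\cdot x)=a$; $a\cdot I$ is a term, $s(a\cdot I)=\{a\}$, $t(a\cdot I)=a$; if $f,g$ are terms and $t(f)\in s(g)$, then $g\triangleleft f$ is a term, $s(g\triangleleft f)=(s(g)\setminus\{t(f)\})\cup s(f)$, $t(g\triangleleft f)=t(g)$.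 Below, indices range over all values for which all the terms that are written exist. **The category $\mathcal{WO}_u$.** The objects are the $u$-terms. The arrow terms are generated from $\mathbf 1_f\colon f\to f$; $\beta_{h,g,f}\colon (h\triangleleft g)\triangleleft f\to h\triangleleft(g\triangleleft f)$ and $\beta^{-1}_{h,g,f}$ in the opposite direction; $\theta_{h,g,f}\colon (h\triangleleft g)\triangleleft f\to(h\triangleleft f)\triangleleft g$, provided $t(f)\neq t(g)$; $\mu_{f,a}\colon f\triangleleft a\cdot I\to f$ and $\lambda_f\colon t(f)\cdot I\triangleleft f\to f$, and $\mu^{-1}_{f,a}$, $\lambda^{-1}_f$ in the opposite directions, by composition $v\circ u$ and by $v\triangleleft u\colon g\triangleleft f\to g'\triangleleft f'$ for $u\colon f\to f'$, $v\colon g\to g'$. The arrows are the classes of arrow terms of the same type under the least equivalence relation that is a congruence for $\circ$ and $\triangleleft$ and contains the equations of a category and, for $u\colon f_1\to f_2$, $v\colon g_1\to g_2$, $w\colon h_1\to h_2$: - $\mathbf 1_g\triangleleft\mathbf 1_f=\mathbf 1_{g\triangleleft f}$, $(v_2\circ v_1)\triangleleft(u_2\circ u_1)=(v_2\triangleleft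 u_2)\circ(v_1\triangleleft u_1)$; - $\beta_{h_2,g_2,f_2}\circ((w\triangleleft v)\triangleleft u)=(w\triangleleft(v\triangleleft u))\circ\beta_{h_1,g_1,f_1}$, $\theta_{h_2,g_2,f_2}\circ((w\triangleleft v)\triangleleft u)=((w\triangleleft u)\triangleleft v)\circ\theta_{h_1,g_1,f_1}$; - $\mu_{f_2,a}\circ(u\triangleleft\mathbf 1_{a\cdot I})=u\circ\mu_{f_1,a}$, $\lambda_{f_2}\circ(\mathbf 1_{t(f_1)\cdot I}\triangleleft u)=u\circ\lambda_{f_1}$; - $\beta^{-1}$, $\mu^{-1}$, $\lambda^{-1}$ are two-sided inverses of $\beta$, $\mu$, $\lambda$, and $\theta_{h,f,g}\circ\theta_{h,g,f}=\mathbf 1_{(h\triangleleft g)\triangleleft f}$; - $(\mathbf 1_j\triangleleft\beta_{h,g,f})\circ\beta_{j,h\triangleleft g,f}\circ(\beta_{j,h,g}\triangleleft\mathbf 1_f)=\beta_{j,h,g\triangleleft f}\circ\beta_{j\triangleleft h,g,f}$; - $\theta_{j\triangleleft f,h,g}\circ(\theta_{j,h,f}\triangleleft\mathbf 1_g)\circ\theta_{j\triangleleft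 h,g,f}=(\theta_{j,g,f}\triangleleft\mathbf 1_h)\circ\theta_{j\triangleleft g,h,f}\circ(\theta_{j,h,g}\triangleleft\mathbf 1_f)$; - $(\mathbf 1_j\triangleleft\theta_{h,g,f})\circ\beta_{j,h\triangleleft g,f}\circ(\beta_{j,h,g}\triangleleft\mathbf 1_f)=\beta_{j,h\triangleleft f,g}\circ(\beta_{j,h,f}\triangleleft\mathbf 1_g)\circ\theta_{j\triangleleft h,g,f}$; - $\theta_{j,h\triangleleft g,f}\circ(\beta_{j,h,g}\triangleleft\mathbf 1_f)=\beta_{j\triangleleft f,h,g}\circ(\theta_{j,h,f}\triangleleft\mathbf 1_g)\circ\theta_{j\triangleleft h,g,f}$; - $\beta_{h,t(f)\cdot I,f}=(\mathbf 1_h\triangleleft\lambda^{-1}_f)\circ(\mu_{h,t(f)}\triangleleft\mathbf 1_f)$, $\theta_{h,b\cdot I,f}=\mu^{-1}_{h\triangleleft f,b}\circ(\mu_{h,b}\triangleleft\mathbf 1_f)$. **The category $\mathcal{WO}_e$.** The objects are the $e$-terms. The arrow terms are generated in the same way from $\mathbf 1_f$; $\beta_{h,(b,g),(a,f)}\colon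 (h\triangleleft_b g)\triangleleft_{ba} f\to h\triangleleft_b(g\triangleleft_a f)$ and $\beta^{-1}_{h,(b,g),(a,f)}$; $\theta_{h,(b,g),(a,f)}\colon (h\triangleleft_b g)\triangleleft_a f\to(h\triangleleft_a f)\triangleleft_b g$, provided $a\neq b$; $\mu_{f,a}\colon f\triangleleft_a I\to f$, $\lambda_f\colon I\triangleleft_e f\to f$, and $\mu^{-1}_{f,a}$, $\lambda^{-1}_f$, by $\circ$ and $v\triangleleft_a u\colon g\triangleleft_a f\to g'\triangleleft_a f'$. The equations are obtained from those of $\mathcal{WO}_u$ by indexing: - $\mathbf 1_g\triangleleft_a\mathbf 1_f=\mathbf 1_{g\triangleleft_a f}$, $(v_2\circ v_1)\triangleleft_a(u_2\circ u_1)=(v_2\triangleleft_a u_2)\circ(v_1\triangleleft_a u_1)$; - $\beta_{h_2,(b,g_2),(a,f_2)}\circ((w\triangleleft_b v)\triangleleft_{ba} u)=(w\triangleleft_b(v\triangleleft_a u))\circ\beta_{h_1,(b,g_1),(a,f_1)}$, $\theta_{h_2,(b,g_2),(a,f_2)}\circ((w\triangleleft_b v)\triangleleft_a u)=((w\triangleleft_a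 u)\triangleleft_b v)\circ\theta_{h_1,(b,g_1),(a,f_1)}$; - $\mu_{f_2,a}\circ(u\triangleleft_a\mathbf 1_I)=u\circ\mu_{f_1,a}$, $\lambda_{f_2}\circ(\mathbf 1_I\triangleleft_e u)=u\circ\lambda_{f_1}$; - $\beta^{-1}$, $\mu^{-1}$, $\lambda^{-1}$ are two-sided inverses of $\beta$, $\mu$, $\lambda$, and $\theta_{h,(a,f),(b,g)}\circ\theta_{h,(b,g),(a,f)}=\mathbf 1_{(h\triangleleft_b g)\triangleleft_a f}$; - $(\mathbf 1_j\triangleleft_c\beta_{h,(b,g),(a,f)})\circ\beta_{j,(c,h\triangleleft_b g),(ba,f)}\circ(\beta_{j,(c,h),(b,g)}\triangleleft_{cba}\mathbf 1_f)=\beta_{j,(c,h),(b,g\triangleleft_a f)}\circ\beta_{j\triangleleft_c h,(cb,g),(a,f)}$; - $\theta_{j\triangleleft_a f,(c,h),(b,g)}\circ(\theta_{j,(c,h),(a,f)}\triangleleft_b\mathbf 1_g)\circ\theta_{j\triangleleft_c h,(b,g),(a,f)}=(\theta_{j,(b,g),(a,f)}\triangleleft_c\mathbf 1_h)\circ\theta_{j\triangleleft_b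 g,(c,h),(a,f)}\circ(\theta_{j,(c,h),(b,g)}\triangleleft_a\mathbf 1_f)$; - $(\mathbf 1_j\triangleleft_c\theta_{h,(b,g),(a,f)})\circ\beta_{j,(c,h\triangleleft_b g),(a,f)}\circ(\beta_{j,(c,h),(b,g)}\triangleleft_{ca}\mathbf 1_f)=\beta_{j,(c,h\triangleleft_a f),(b,g)}\circ(\beta_{j,(c,h),(a,f)}\triangleleft_{cb}\mathbf 1_g)\circ\theta_{j\triangleleft_c h,(cb,g),(ca,f)}$; - $\theta_{j,(c,h\triangleleft_b g),(a,f)}\circ(\beta_{j,(c,h),(b,g)}\triangleleft_a\mathbf 1_f)=\beta_{j\triangleleft_a f,(c,h),(b,g)}\circ(\theta_{j,(c,h),(a,f)}\triangleleft_{cb}\mathbf 1_g)\circ\theta_{j\triangleleft_c h,(cb,g),(a,f)}$; - $\beta_{h,(b,I),(e,f)}=(\mathbf 1_h\triangleleft_b\lambda^{-1}_f)\circ(\mu_{h,b}\triangleleft_b\mathbf 1_f)$, $\theta_{h,(b,I),(a,f)}=\mu^{-1}_{h\triangleleft_a f,b}\circ(\mu_{h,b}\triangleleft_a\mathbf 1_f)$.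 **Theorem.** Any two arrow terms of $\mathcal{WO}_e$ with the same source and target are equal in $\mathcal{WO}_e$, and any two arrow terms of $\mathcal{WO}_u$ with the same source and target are equal in $\mathcal{WO}_u$. In other words, the categories $\mathcal{WO}_e$ and $\mathcal{WO}_u$ are preorders. -/

import Mathlib

namespace WeakCatOperad

open CategoryTheory

universe u

/-- Finite, possibly empty, sequences of positive natural numbers. The empty word is `[]`,
and `ab` is `a ++ b`. -/
abbrev Word : Type := List ℕ+

/-- The language `a · M = {ab | b ∈ M}`. -/
def shift (a : Word) (M : Set Word) : Set Word := {c | ∃ b ∈ M, c = a ++ b}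

/-- The result `(Y - {a}) ∪ X` of inserting `X` in `Y` at `a`. -/
def insertAt (Y : Set Word) (a : Word) (X : Set Word) : Set Word := (Y \ {a}) ∪ X

/-- `{1, …, n}`, as a set of one-letter words, if `n ≠ 1`, and `{e}` if `n = 1`. -/
def genArity (n : ℕ) : Set Word :=
  if n = 1 then {[]} else {w | ∃ k : ℕ+, (k : ℕ) ≤ n ∧ w = [k]}

/-! ### Terms indexed by places: the objects of `WOe` -/

/-- Expressions `x`, `I` and `g ◁_a f`; the terms are those that are legitimate. -/
inductive TermE (G : Type u) : Type u
  | gen (x : G) : TermE G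
  | unit : TermE G
  | ins (g : TermE G) (a : Word) (f : TermE G) : TermE G

namespace TermE

variable {G : Type u}

/-- The nominal arity of a term. -/
def s (α : G → ℕ) : TermE G → Set Word
  | gen x => genArity (α x)
  | unit => {[]}
  | ins g a f => insertAt (s α g) a (shift a (s α f))

/-- Legitimacy: every subexpression `g ◁_a f` satisfies `a ∈ s g`. -/
def Legit (α : G → ℕ) : TermE G → Prop
  | gen _ => True
  | unit => True
  | ins g a f => g.Legit α ∧ f.Legit α ∧ a ∈ g.s α

end TermE

/-- Legitimacy of the indices of `β_{h,(b,g),(a,f)}` and of its inverse, with `c = ba`. -/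
structure BetaE {G : Type u} (α : G → ℕ) (h : TermE G) (b : Word) (g : TermE G) (a : Word)
    (f : TermE G) (c : Word) : Prop where
  word : c = b ++ a
  left : ((h.ins b g).ins c f).Legit α
  right : (h.ins b (g.ins a f)).Legit α

/-- Legitimacy of the indices of `θ_{h,(b,g),(a,f)}`: the two insertions are made in `h` at
different places. -/
structure ThetaE {G : Type u} (α : G → ℕ) (h : TermE G) (b : Word) (g : TermE G) (a : Word)
    (f : TermE G) : Prop where
  ne : a ≠ b
  left : ((h.ins b g).ins a f).Legit α
  right : ((h.ins a f).ins b g).Legit α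

/-- The arrow terms of `WOe` of type `f → g`. Here `comp v u` is `v ∘ u`, and `ins a v u` is
`v ◁_a u`. -/
inductive ArrowE {G : Type u} (α : G → ℕ) : TermE G → TermE G → Type u
  | id (f : TermE G) (p : f.Legit α) : ArrowE α f f
  | beta (h : TermE G) (b : Word) (g : TermE G) (a : Word) (f : TermE G) (c : Word)
      (p : BetaE α h b g a f c) : ArrowE α ((h.ins b g).ins c f) (h.ins b (g.ins a f))
  | betaInv (h : TermE G) (b : Word) (g : TermE G) (a : Word) (f : TermE G) (c : Word)
      (p : BetaE α h b g a f c) : ArrowE α (h.ins b (g.ins a f)) ((h.ins b g).ins c f)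
  | theta (h : TermE G) (b : Word) (g : TermE G) (a : Word) (f : TermE G)
      (p : ThetaE α h b g a f) : ArrowE α ((h.ins b g).ins a f) ((h.ins a f).ins b g)
  | mu (f : TermE G) (a : Word) (p : (f.ins a .unit).Legit α) : ArrowE α (f.ins a .unit) f
  | muInv (f : TermE G) (a : Word) (p : (f.ins a .unit).Legit α) : ArrowE α f (f.ins a .unit)
  | lam (f : TermE G) (p : f.Legit α) : ArrowE α (TermE.unit.ins [] f) f
  | lamInv (f : TermE G) (p : f.Legit α) : ArrowE α f (TermE.unit.ins [] f)
  | comp {f g h : TermE G} (v : ArrowE α g h) (u : ArrowE α f g) : ArrowE α f h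
  | ins {g g' f f' : TermE G} (a : Word) (v : ArrowE α g g') (u : ArrowE α f f')
      (p : (g.ins a f).Legit α) (p' : (g'.ins a f').Legit α) :
      ArrowE α (g.ins a f) (g'.ins a f')

namespace ArrowE

/-- The equations of `WOe` between arrow terms of the same type. All the expressions that occur
in an axiomatic equation are assumed legitimate. -/
inductive Equ {G : Type u} {α : G → ℕ} :
    ∀ {f g : TermE G}, ArrowE α f g → ArrowE α f g → Prop
  -- equational rules
  | refl {f g} (u : ArrowE α f g) : Equ u u
  | symm {f g} {u v : ArrowE α f g} : Equ u v → Equ v u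
  | trans {f g} {u v w : ArrowE α f g} : Equ u v → Equ v w → Equ u w
  | comp_congr {f g h} {v₁ v₂ : ArrowE α g h} {u₁ u₂ : ArrowE α f g} :
      Equ u₁ u₂ → Equ v₁ v₂ → Equ (comp v₁ u₁) (comp v₂ u₂)
  | ins_congr {g g' f f'} (a : Word) {v₁ v₂ : ArrowE α g g'} {u₁ u₂ : ArrowE α f f'} (p p') :
      Equ u₁ u₂ → Equ v₁ v₂ → Equ (ins a v₁ u₁ p p') (ins a v₂ u₂ p p')
  -- categorial equations
  | comp_id {f g} (u : ArrowE α f g) (p) : Equ (comp u (id f p)) u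
  | id_comp {f g} (u : ArrowE α f g) (p) : Equ (comp (id g p) u) u
  | assoc {f g h k} (w : ArrowE α h k) (v : ArrowE α g h) (u : ArrowE α f g) :
      Equ (comp (comp w v) u) (comp w (comp v u))
  -- bifunctoriality of insertion
  | ins_id (g f : TermE G) (a : Word) (pg pf p) :
      Equ (ins a (id g pg) (id f pf) p p) (id (g.ins a f) p)
  | ins_comp {g₁ g₂ g₃ f₁ f₂ f₃} (a : Word) (v₂ : ArrowE α g₂ g₃) (v₁ : ArrowE α g₁ g₂)
      (u₂ : ArrowE α f₂ f₃) (u₁ : ArrowE α f₁ f₂) (p₁ p₂ p₃) :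
      Equ (ins a (comp v₂ v₁) (comp u₂ u₁) p₁ p₃) (comp (ins a v₂ u₂ p₂ p₃) (ins a v₁ u₁ p₁ p₂))
  -- naturality of `β` and `θ`
  | beta_nat {h₁ h₂ g₁ g₂ f₁ f₂} (b a c : Word)
      (w : ArrowE α h₁ h₂) (v : ArrowE α g₁ g₂) (u : ArrowE α f₁ f₂)
      (p₁ : BetaE α h₁ b g₁ a f₁ c) (p₂ : BetaE α h₂ b g₂ a f₂ c) (q₁ q₂ q₃ q₄) :
      Equ (comp (beta h₂ b g₂ a f₂ c p₂) (ins c (ins b w v q₁ q₂) u p₁.left p₂.left))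
        (comp (ins b w (ins a v u q₃ q₄) p₁.right p₂.right) (beta h₁ b g₁ a f₁ c p₁))
  | theta_nat {h₁ h₂ g₁ g₂ f₁ f₂} (b a : Word)
      (w : ArrowE α h₁ h₂) (v : ArrowE α g₁ g₂) (u : ArrowE α f₁ f₂)
      (p₁ : ThetaE α h₁ b g₁ a f₁) (p₂ : ThetaE α h₂ b g₂ a f₂) (q₁ q₂ q₃ q₄) :
      Equ (comp (theta h₂ b g₂ a f₂ p₂) (ins a (ins b w v q₁ q₂) u p₁.left p₂.left))
        (comp (ins b (ins a w u q₃ q₄) v p₁.right p₂.right) (theta h₁ b g₁ a f₁ p₁))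
  -- invertibility of `β` and `θ`
  | betaInv_beta (h b g a f c) (p : BetaE α h b g a f c) :
      Equ (comp (betaInv h b g a f c p) (beta h b g a f c p)) (id _ p.left)
  | beta_betaInv (h b g a f c) (p : BetaE α h b g a f c) :
      Equ (comp (beta h b g a f c p) (betaInv h b g a f c p)) (id _ p.right)
  | theta_theta (h b g a f) (p : ThetaE α h b g a f) (p' : ThetaE α h a f b g) :
      Equ (comp (theta h a f b g p') (theta h b g a f p)) (id _ p.left)
  -- `h` is inserted in `j` at `c`, `g` in `h` at `b`, and `f` in `g` at `a`
  | beta_pent (j h g f : TermE G) (c b a cb ba cba : Word) (pj pf)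
      (p₁ : BetaE α h b g a f ba) (p₂ : BetaE α j c (h.ins b g) ba f cba)
      (p₃ : BetaE α j c h b g cb) (p₄ : BetaE α j c h b (g.ins a f) cb)
      (p₅ : BetaE α (j.ins c h) cb g a f cba) (q₁ q₂ q₃ q₄) :
      Equ (comp (ins c (id j pj) (beta h b g a f ba p₁) q₁ q₂)
          (comp (beta j c (h.ins b g) ba f cba p₂)
            (ins cba (beta j c h b g cb p₃) (id f pf) q₃ q₄)))
        (comp (beta j c h b (g.ins a f) cb p₄) (beta (j.ins c h) cb g a f cba p₅))
  -- `h`, `g` and `f` are inserted in `j` at `c`, `b` and `a`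
  | theta_YB (j h g f : TermE G) (c b a : Word) (ph pg pf)
      (p₁ : ThetaE α (j.ins a f) c h b g) (p₂ : ThetaE α j c h a f)
      (p₃ : ThetaE α (j.ins c h) b g a f) (p₄ : ThetaE α j b g a f)
      (p₅ : ThetaE α (j.ins b g) c h a f) (p₆ : ThetaE α j c h b g) (q₁ q₂ q₃ q₄ q₅ q₆) :
      Equ (comp (theta (j.ins a f) c h b g p₁)
          (comp (ins b (theta j c h a f p₂) (id g pg) q₁ q₂) (theta (j.ins c h) b g a f p₃)))
        (comp (ins c (theta j b g a f p₄) (id h ph) q₃ q₄)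
          (comp (theta (j.ins b g) c h a f p₅) (ins a (theta j c h b g p₆) (id f pf) q₅ q₆)))
  -- `h` is inserted in `j` at `c`, and `g` and `f` in `h` at `b` and `a`
  | beta_theta_one (j h g f : TermE G) (c b a cb ca : Word) (pj pg pf)
      (p₁ : ThetaE α h b g a f) (p₂ : BetaE α j c (h.ins b g) a f ca)
      (p₃ : BetaE α j c h b g cb) (p₄ : BetaE α j c (h.ins a f) b g cb)
      (p₅ : BetaE α j c h a f ca) (p₆ : ThetaE α (j.ins c h) cb g ca f) (q₁ q₂ q₃ q₄ q₅ q₆) :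
      Equ (comp (ins c (id j pj) (theta h b g a f p₁) q₁ q₂)
          (comp (beta j c (h.ins b g) a f ca p₂)
            (ins ca (beta j c h b g cb p₃) (id f pf) q₃ q₄)))
        (comp (beta j c (h.ins a f) b g cb p₄)
          (comp (ins cb (beta j c h a f ca p₅) (id g pg) q₅ q₆)
            (theta (j.ins c h) cb g ca f p₆)))
  -- `h` and `f` are inserted in `j` at `c` and `a`, and `g` in `h` at `b`
  | beta_theta_two (j h g f : TermE G) (c b a cb : Word) (pg pf)
      (p₁ : ThetaE α j c (h.ins b g) a f) (p₂ : BetaE α j c h b g cb)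
      (p₃ : BetaE α (j.ins a f) c h b g cb) (p₄ : ThetaE α j c h a f)
      (p₅ : ThetaE α (j.ins c h) cb g a f) (q₁ q₂ q₃ q₄) :
      Equ (comp (theta j c (h.ins b g) a f p₁) (ins a (beta j c h b g cb p₂) (id f pf) q₁ q₂))
        (comp (beta (j.ins a f) c h b g cb p₃)
          (comp (ins cb (theta j c h a f p₄) (id g pg) q₃ q₄) (theta (j.ins c h) cb g a f p₅)))
  -- the unit
  | mu_nat {f₁ f₂} (u : ArrowE α f₁ f₂) (a : Word) (p₁ p₂ q) :
      Equ (comp (mu f₂ a p₂) (ins a u (id .unit q) p₁ p₂)) (comp u (mu f₁ a p₁))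
  | lam_nat {f₁ f₂} (u : ArrowE α f₁ f₂) (p₁ p₂ q q₁ q₂) :
      Equ (comp (lam f₂ p₂) (ins [] (id .unit q) u q₁ q₂)) (comp u (lam f₁ p₁))
  | muInv_mu (f a p) : Equ (comp (muInv f a p) (mu f a p)) (id (α := α) (f.ins a .unit) p)
  | mu_muInv (f a p q) : Equ (comp (mu f a p) (muInv f a p)) (id (α := α) f q)
  | lamInv_lam (f p q) : Equ (comp (lamInv f p) (lam f p)) (id (α := α) (TermE.unit.ins [] f) q)
  | lam_lamInv (f p) : Equ (comp (lam f p) (lamInv f p)) (id (α := α) f p)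
  | beta_mu_lam (h f : TermE G) (b : Word) (ph pf) (p : BetaE α h b .unit [] f b)
      (p' : (h.ins b .unit).Legit α) (q₁ q₂ q₃) :
      Equ (beta h b .unit [] f b p)
        (comp (ins b (id h ph) (lamInv f pf) q₁ q₂) (ins b (mu h b p') (id f pf) q₃ q₁))
  | theta_mu (h f : TermE G) (b a : Word) (pf) (p : ThetaE α h b .unit a f)
      (p' : (h.ins b .unit).Legit α) (q₁ q₂) :
      Equ (theta h b .unit a f p)
        (comp (muInv (h.ins a f) b p.right) (ins a (mu h b p') (id f pf) q₁ q₂))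

end ArrowE

/-- Objects of the category `WOe` freely generated by `α : G → ℕ`: the legitimate terms. -/
structure WOe {G : Type u} (α : G → ℕ) : Type u where
  term : TermE G
  legit : term.Legit α

/-- Arrow terms of the same type, up to the equations of `WOe`. -/
def ArrowE.setoid {G : Type u} (α : G → ℕ) (f g : TermE G) : Setoid (ArrowE α f g) where
  r := ArrowE.Equ
  iseqv := ⟨.refl, .symm, .trans⟩

/-- The category `WOe`: arrows are equivalence classes of arrow terms. -/
instance WOe.category {G : Type u} (α : G → ℕ) : Category.{u} (WOe α) where
  Hom f g := Quotient (ArrowE.setoid α f.term g.term)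
  id f := Quotient.mk _ (.id f.term f.legit)
  comp u v := Quotient.map₂ (fun u v => .comp v u)
    (fun _ _ hu _ _ hv => ArrowE.Equ.comp_congr hu hv) u v
  id_comp := by
    rintro f g ⟨u⟩
    exact Quotient.sound (.comp_id u f.legit)
  comp_id := by
    rintro f g ⟨u⟩
    exact Quotient.sound (.id_comp u g.legit)
  assoc := by
    rintro f g h k ⟨u⟩ ⟨v⟩ ⟨w⟩
    exact Quotient.sound (.symm (.assoc w v u))

/-! ### Terms with diversified generators: the objects of `WOu` -/

/-- Expressions `a · x`, `a · I` and `g ◁ f`; the terms are those that are legitimate. -/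
inductive TermU (G : Type u) : Type u
  | gen (a : Word) (x : G) : TermU G
  | unit (a : Word) : TermU G
  | ins (g f : TermU G) : TermU G

namespace TermU

variable {G : Type u}

/-- The target word of a term. -/
def t : TermU G → Word
  | gen a _ => a
  | unit a => a
  | ins g _ => t g

/-- The nominal arity of a term. -/
def s (α : G → ℕ) : TermU G → Set Word
  | gen a x => shift a (genArity (α x))
  | unit a => {a}
  | ins g f => insertAt (s α g) (t f) (s α f)

/-- Legitimacy: every subexpression `g ◁ f` satisfies `t f ∈ s g`. -/
def Legit (α : G → ℕ) : TermU G → Prop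
  | gen _ _ => True
  | unit _ => True
  | ins g f => g.Legit α ∧ f.Legit α ∧ f.t ∈ g.s α

end TermU

/-- Legitimacy of the indices of `β_{h,g,f}` and of its inverse. -/
structure BetaU {G : Type u} (α : G → ℕ) (h g f : TermU G) : Prop where
  left : ((h.ins g).ins f).Legit α
  right : (h.ins (g.ins f)).Legit α

/-- Legitimacy of the indices of `θ_{h,g,f}`: the two insertions are made in `h` at different
places. -/
structure ThetaU {G : Type u} (α : G → ℕ) (h g f : TermU G) : Prop where
  ne : f.t ≠ g.t
  left : ((h.ins g).ins f).Legit α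
  right : ((h.ins f).ins g).Legit α

/-- The arrow terms of `WOu` of type `f → g`. Here `comp v u` is `v ∘ u`, and `ins v u` is
`v ◁ u`. In `lam a f`, which is `λ_f`, the legitimacy of `a · I ◁ f` says that `a` is `t f`. -/
inductive ArrowU {G : Type u} (α : G → ℕ) : TermU G → TermU G → Type u
  | id (f : TermU G) (p : f.Legit α) : ArrowU α f f
  | beta (h g f : TermU G) (p : BetaU α h g f) : ArrowU α ((h.ins g).ins f) (h.ins (g.ins f))
  | betaInv (h g f : TermU G) (p : BetaU α h g f) : ArrowU α (h.ins (g.ins f)) ((h.ins g).ins f)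
  | theta (h g f : TermU G) (p : ThetaU α h g f) : ArrowU α ((h.ins g).ins f) ((h.ins f).ins g)
  | mu (f : TermU G) (a : Word) (p : (f.ins (.unit a)).Legit α) : ArrowU α (f.ins (.unit a)) f
  | muInv (f : TermU G) (a : Word) (p : (f.ins (.unit a)).Legit α) : ArrowU α f (f.ins (.unit a))
  | lam (a : Word) (f : TermU G) (p : ((TermU.unit a).ins f).Legit α) :
      ArrowU α ((TermU.unit a).ins f) f
  | lamInv (a : Word) (f : TermU G) (p : ((TermU.unit a).ins f).Legit α) :
      ArrowU α f ((TermU.unit a).ins f)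
  | comp {f g h : TermU G} (v : ArrowU α g h) (u : ArrowU α f g) : ArrowU α f h
  | ins {g g' f f' : TermU G} (v : ArrowU α g g') (u : ArrowU α f f')
      (p : (g.ins f).Legit α) (p' : (g'.ins f').Legit α) : ArrowU α (g.ins f) (g'.ins f')

namespace ArrowU

/-- The equations of `WOu` between arrow terms of the same type. All the expressions that occur
in an axiomatic equation are assumed legitimate. -/
inductive Equ {G : Type u} {α : G → ℕ} :
    ∀ {f g : TermU G}, ArrowU α f g → ArrowU α f g → Prop
  -- equational rules
  | refl {f g} (u : ArrowU α f g) : Equ u u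
  | symm {f g} {u v : ArrowU α f g} : Equ u v → Equ v u
  | trans {f g} {u v w : ArrowU α f g} : Equ u v → Equ v w → Equ u w
  | comp_congr {f g h} {v₁ v₂ : ArrowU α g h} {u₁ u₂ : ArrowU α f g} :
      Equ u₁ u₂ → Equ v₁ v₂ → Equ (comp v₁ u₁) (comp v₂ u₂)
  | ins_congr {g g' f f'} {v₁ v₂ : ArrowU α g g'} {u₁ u₂ : ArrowU α f f'} (p p') :
      Equ u₁ u₂ → Equ v₁ v₂ → Equ (ins v₁ u₁ p p') (ins v₂ u₂ p p')
  -- categorial equations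
  | comp_id {f g} (u : ArrowU α f g) (p) : Equ (comp u (id f p)) u
  | id_comp {f g} (u : ArrowU α f g) (p) : Equ (comp (id g p) u) u
  | assoc {f g h k} (w : ArrowU α h k) (v : ArrowU α g h) (u : ArrowU α f g) :
      Equ (comp (comp w v) u) (comp w (comp v u))
  -- bifunctoriality of insertion
  | ins_id (g f : TermU G) (pg pf p) :
      Equ (ins (id g pg) (id f pf) p p) (id (g.ins f) p)
  | ins_comp {g₁ g₂ g₃ f₁ f₂ f₃} (v₂ : ArrowU α g₂ g₃) (v₁ : ArrowU α g₁ g₂)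
      (u₂ : ArrowU α f₂ f₃) (u₁ : ArrowU α f₁ f₂) (p₁ p₂ p₃) :
      Equ (ins (comp v₂ v₁) (comp u₂ u₁) p₁ p₃) (comp (ins v₂ u₂ p₂ p₃) (ins v₁ u₁ p₁ p₂))
  -- naturality of `β` and `θ`
  | beta_nat {h₁ h₂ g₁ g₂ f₁ f₂}
      (w : ArrowU α h₁ h₂) (v : ArrowU α g₁ g₂) (u : ArrowU α f₁ f₂)
      (p₁ : BetaU α h₁ g₁ f₁) (p₂ : BetaU α h₂ g₂ f₂) (q₁ q₂ q₃ q₄) :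
      Equ (comp (beta h₂ g₂ f₂ p₂) (ins (ins w v q₁ q₂) u p₁.left p₂.left))
        (comp (ins w (ins v u q₃ q₄) p₁.right p₂.right) (beta h₁ g₁ f₁ p₁))
  | theta_nat {h₁ h₂ g₁ g₂ f₁ f₂}
      (w : ArrowU α h₁ h₂) (v : ArrowU α g₁ g₂) (u : ArrowU α f₁ f₂)
      (p₁ : ThetaU α h₁ g₁ f₁) (p₂ : ThetaU α h₂ g₂ f₂) (q₁ q₂ q₃ q₄) :
      Equ (comp (theta h₂ g₂ f₂ p₂) (ins (ins w v q₁ q₂) u p₁.left p₂.left))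
        (comp (ins (ins w u q₃ q₄) v p₁.right p₂.right) (theta h₁ g₁ f₁ p₁))
  -- invertibility of `β` and `θ`
  | betaInv_beta (h g f) (p : BetaU α h g f) :
      Equ (comp (betaInv h g f p) (beta h g f p)) (id _ p.left)
  | beta_betaInv (h g f) (p : BetaU α h g f) :
      Equ (comp (beta h g f p) (betaInv h g f p)) (id _ p.right)
  | theta_theta (h g f) (p : ThetaU α h g f) (p' : ThetaU α h f g) :
      Equ (comp (theta h f g p') (theta h g f p)) (id _ p.left)
  -- coherence conditions for `β` and `θ`
  | beta_pent (j h g f : TermU G) (pj pf)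
      (p₁ : BetaU α h g f) (p₂ : BetaU α j (h.ins g) f) (p₃ : BetaU α j h g)
      (p₄ : BetaU α j h (g.ins f)) (p₅ : BetaU α (j.ins h) g f) (q₁ q₂ q₃ q₄) :
      Equ (comp (ins (id j pj) (beta h g f p₁) q₁ q₂)
          (comp (beta j (h.ins g) f p₂) (ins (beta j h g p₃) (id f pf) q₃ q₄)))
        (comp (beta j h (g.ins f) p₄) (beta (j.ins h) g f p₅))
  | theta_YB (j h g f : TermU G) (ph pg pf)
      (p₁ : ThetaU α (j.ins f) h g) (p₂ : ThetaU α j h f) (p₃ : ThetaU α (j.ins h) g f)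
      (p₄ : ThetaU α j g f) (p₅ : ThetaU α (j.ins g) h f) (p₆ : ThetaU α j h g)
      (q₁ q₂ q₃ q₄ q₅ q₆) :
      Equ (comp (theta (j.ins f) h g p₁)
          (comp (ins (theta j h f p₂) (id g pg) q₁ q₂) (theta (j.ins h) g f p₃)))
        (comp (ins (theta j g f p₄) (id h ph) q₃ q₄)
          (comp (theta (j.ins g) h f p₅) (ins (theta j h g p₆) (id f pf) q₅ q₆)))
  | beta_theta_one (j h g f : TermU G) (pj pg pf)
      (p₁ : ThetaU α h g f) (p₂ : BetaU α j (h.ins g) f) (p₃ : BetaU α j h g)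
      (p₄ : BetaU α j (h.ins f) g) (p₅ : BetaU α j h f) (p₆ : ThetaU α (j.ins h) g f)
      (q₁ q₂ q₃ q₄ q₅ q₆) :
      Equ (comp (ins (id j pj) (theta h g f p₁) q₁ q₂)
          (comp (beta j (h.ins g) f p₂) (ins (beta j h g p₃) (id f pf) q₃ q₄)))
        (comp (beta j (h.ins f) g p₄)
          (comp (ins (beta j h f p₅) (id g pg) q₅ q₆) (theta (j.ins h) g f p₆)))
  | beta_theta_two (j h g f : TermU G) (pg pf)
      (p₁ : ThetaU α j (h.ins g) f) (p₂ : BetaU α j h g) (p₃ : BetaU α (j.ins f) h g)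
      (p₄ : ThetaU α j h f) (p₅ : ThetaU α (j.ins h) g f) (q₁ q₂ q₃ q₄) :
      Equ (comp (theta j (h.ins g) f p₁) (ins (beta j h g p₂) (id f pf) q₁ q₂))
        (comp (beta (j.ins f) h g p₃)
          (comp (ins (theta j h f p₄) (id g pg) q₃ q₄) (theta (j.ins h) g f p₅)))
  -- the units
  | mu_nat {f₁ f₂} (u : ArrowU α f₁ f₂) (a : Word) (p₁ p₂ q) :
      Equ (comp (mu f₂ a p₂) (ins u (id (.unit a) q) p₁ p₂)) (comp u (mu f₁ a p₁))
  | lam_nat {f₁ f₂} (u : ArrowU α f₁ f₂) (a : Word) (p₁ p₂ q) :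
      Equ (comp (lam a f₂ p₂) (ins (id (.unit a) q) u p₁ p₂)) (comp u (lam a f₁ p₁))
  | muInv_mu (f a p) : Equ (comp (muInv f a p) (mu f a p)) (id (α := α) (f.ins (.unit a)) p)
  | mu_muInv (f a p q) : Equ (comp (mu f a p) (muInv f a p)) (id (α := α) f q)
  | lamInv_lam (a f p) :
      Equ (comp (lamInv a f p) (lam a f p)) (id (α := α) ((TermU.unit a).ins f) p)
  | lam_lamInv (a f p q) : Equ (comp (lam a f p) (lamInv a f p)) (id (α := α) f q)
  | beta_mu_lam (h f : TermU G) (a : Word) (ph pf) (p : BetaU α h (.unit a) f)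
      (pl : ((TermU.unit a).ins f).Legit α) (pm : (h.ins (.unit a)).Legit α) (q) :
      Equ (beta h (.unit a) f p)
        (comp (ins (id h ph) (lamInv a f pl) q p.right) (ins (mu h a pm) (id f pf) p.left q))
  | theta_mu (h f : TermU G) (b : Word) (pf) (p : ThetaU α h (.unit b) f)
      (pm : (h.ins (.unit b)).Legit α) (q) :
      Equ (theta h (.unit b) f p)
        (comp (muInv (h.ins f) b p.right) (ins (mu h b pm) (id f pf) p.left q))

end ArrowU

/-- Objects of the category `WOu` freely generated by `α : G → ℕ`: the legitimate terms. -/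
structure WOu {G : Type u} (α : G → ℕ) : Type u where
  term : TermU G
  legit : term.Legit α

/-- Arrow terms of the same type, up to the equations of `WOu`. -/
def ArrowU.setoid {G : Type u} (α : G → ℕ) (f g : TermU G) : Setoid (ArrowU α f g) where
  r := ArrowU.Equ
  iseqv := ⟨.refl, .symm, .trans⟩

/-- The category `WOu`: arrows are equivalence classes of arrow terms. -/
instance WOu.category {G : Type u} (α : G → ℕ) : Category.{u} (WOu α) where
  Hom f g := Quotient (ArrowU.setoid α f.term g.term)
  id f := Quotient.mk _ (.id f.term f.legit)
  comp u v := Quotient.map₂ (fun u v => .comp v u)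
    (fun _ _ hu _ _ hv => ArrowU.Equ.comp_congr hu hv) u v
  id_comp := by
    rintro f g ⟨u⟩
    exact Quotient.sound (.comp_id u f.legit)
  comp_id := by
    rintro f g ⟨u⟩
    exact Quotient.sound (.id_comp u g.legit)
  assoc := by
    rintro f g h k ⟨u⟩ ⟨v⟩ ⟨w⟩
    exact Quotient.sound (.symm (.assoc w v u))

end WeakCatOperad

namespace WeakCatOperad

open CategoryTheory

universe u

/-! ### Words -/

/-! Coherence is proved by rewriting, with arrows in place of bare reductions. Orient the generating
isomorphisms: `β` as given, `μ` and `λ` towards the removal of units, and `θ` only in the direction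
that puts two insertions into increasing lexicographic order of places. These steps terminate
(`wellFounded_step`): `θ` keeps a weight that the others lower, and it removes an inversion. They
are locally confluent by commuting diagrams (`join_of_step`): steps that do not interfere commute by
naturality or bifunctoriality, and each overlap is closed by a coherence equation or by a unit law
derived from these, in the way in which Kelly derived the redundant unit axioms of monoidal
categories.

Newman's argument (`join_of_path`) then completes any two paths with the same legitimate source to a
commuting square. Every step is an isomorphism, so continuing to a normal form shows that parallel
paths are equal (`Path.eq`). An arrow built from steps and their inverses becomes a path after
composition with a path (`Reducible`), and two parallel arrows of this kind are equal
(`Reducible.eq`).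

The orientation of `θ` is sound because the nominal arity of a legitimate term is prefix-free. Two
distinct places of one term first differ at some letter, so their order does not change when they
are extended. In two successive insertions, either the earlier place is a prefix of the later one,
which is the situation of `β`, or the places are independent, which is that of `θ`.

Both categories are instances of `InsertionSystem`, whose category lives on all expressions. An
arrow there is an equivalence of legitimacies together with a class of arrow terms, given only when
the source is legitimate; thus `β` and `θ` need no legitimacy hypothesis. Places inside an inserted
term are relative in one category and absolute in the other, and `Assoc` absorbs the difference. The
terms with diversified generators are encoded by labelling each insertion with the target word of
what is inserted. -/

/-- Neither of the two words is a prefix of the other. -/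
def Indep (a b : Word) : Prop := ¬ a <+: b ∧ ¬ b <+: a

theorem Indep.symm {a b : Word} (h : Indep a b) : Indep b a := ⟨h.2, h.1⟩

theorem Indep.ne {a b : Word} (h : Indep a b) : a ≠ b := fun e => h.1 (e ▸ List.prefix_rfl)

theorem Indep.prefix_right {a b c : Word} (h : Indep a b) (hp : b <+: c) : Indep a c := by
  refine ⟨fun hac => ?_, fun hca => h.2 (hp.trans hca)⟩
  rcases List.prefix_or_prefix_of_prefix hac hp with h' | h'
  exacts [h.1 h', h.2 h']

theorem indep_append_left {c a b : Word} : Indep (c ++ a) (c ++ b) ↔ Indep a b := by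
  simp [Indep]

theorem append_lt_append_left_iff {c a b : Word} : c ++ a < c ++ b ↔ a < b := by
  induction c with
  | nil => simp
  | cons x c ih => simp [ih]

theorem Indep.exists_eq {a b : Word} (h : Indep a b) :
    ∃ (p : Word) (x y : ℕ+) (a' b' : Word), x ≠ y ∧ a = p ++ x :: a' ∧ b = p ++ y :: b' := by
  induction a generalizing b with
  | nil => exact absurd (List.nil_prefix) h.1
  | cons x a ih =>
    cases b with
    | nil => exact absurd (List.nil_prefix) h.2
    | cons y b =>
      by_cases hxy : x = y
      · subst hxy
        have h' : Indep a b := by simpa [Indep] using h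
        obtain ⟨p, z, w, a', b', hne, rfl, rfl⟩ := ih h'
        exact ⟨x :: p, z, w, a', b', hne, rfl, rfl⟩
      · exact ⟨[], x, y, a, b, hxy, rfl, rfl⟩

/-- The lexicographic comparison is settled at the first letter where the words differ, which lies
within both of them. -/
theorem Indep.append_lt_append_iff {a b : Word} (h : Indep a b) (c d : Word) :
    a ++ c < b ++ d ↔ a < b := by
  obtain ⟨p, x, y, a', b', hne, rfl, rfl⟩ := h.exists_eq
  simp only [List.append_assoc, append_lt_append_left_iff, List.cons_append,
    List.cons_lt_cons_iff, hne, false_and, or_false]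

theorem Indep.lt_of_prefix {a c x : Word} (h : Indep a c) (hp : c <+: x) : x < a ↔ c < a := by
  obtain ⟨d, rfl⟩ := hp
  simpa using h.symm.append_lt_append_iff d []

theorem Indep.lt_of_prefix' {a c x : Word} (h : Indep a c) (hp : c <+: x) : a < x ↔ a < c := by
  obtain ⟨d, rfl⟩ := hp
  simpa using h.append_lt_append_iff [] d

/-- Independence is not transitive in general, but it is along a chain: if one of `a`, `c` were a
prefix of the other, both would lie on the same side of `b`. -/
theorem Indep.trans_lt {a b c : Word} (hab : Indep a b) (hbc : Indep b c) (h₁ : a < b)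
    (h₂ : b < c) : Indep a c := by
  refine ⟨fun h => ?_, fun h => ?_⟩
  · exact absurd ((hab.symm.lt_of_prefix h).2 h₁) (lt_asymm h₂)
  · exact absurd ((hbc.lt_of_prefix' h).2 h₂) (lt_asymm h₁)

/-! ### Insertion systems -/

/-- What the two categories have in common: a category structure on all expressions, with
isomorphisms `β`, `θ`, `μ` and `λ` subject to the coherence conditions. `Assoc b a c` says that
insertion at `c` after an insertion at `b` amounts to an insertion at the place `a` of what was
inserted at `b`. -/
class InsertionSystem (L : Type u) extends Category.{u} (TermE L) where
  Legit : TermE L → Prop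
  IsUnit : TermE L → Prop
  Assoc : Word → Word → Word → Prop
  -- legitimacy
  legit_iff {f g : TermE L} (u : f ⟶ g) : Legit f ↔ Legit g
  legit_left {g f : TermE L} {a : Word} : Legit (g.ins a f) → Legit g
  legit_right {g f : TermE L} {a : Word} : Legit (g.ins a f) → Legit f
  -- places
  assoc_prefix {b a c : Word} : Assoc b a c → b <+: c
  assoc_unique {b a a' c : Word} : Assoc b a c → Assoc b a' c → a = a'
  assoc_assoc {c b cb a x : Word} : Assoc c b cb → Assoc cb a x →
    ∃ ba, Assoc b a ba ∧ Assoc c ba x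
  -- This governs the overlap of `β` and `θ`: with `x` inside what was inserted at `c`, the smaller
  -- place `a` is either outside it, and then below `c`, or inside it, and then below `x` in
  -- relative terms as well.
  assoc_split {c b x a : Word} : Assoc c b x → Indep x a → a < x →
    (Indep c a ∧ a < c) ∨ ∃ a', Assoc c a' a ∧ Indep b a' ∧ a' < b
  -- units
  unit_ne_ins {g f : TermE L} {a : Word} : ¬ IsUnit (g.ins a f)
  unit_place {i f g : TermE L} {a b : Word} : IsUnit i → Legit (i.ins a f) → Legit (i.ins b g) →
    a = b
  unit_unit {i j : TermE L} {a : Word} : IsUnit i → IsUnit j → Legit (i.ins a j) → i = j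
  unit_assoc_right {h i f : TermE L} {b a c : Word} : IsUnit i → Assoc b a c →
    Legit (h.ins b (i.ins a f)) → c = b
  unit_assoc_left {i g f : TermE L} {b a c : Word} : IsUnit i → Assoc b a c →
    Legit (i.ins b (g.ins a f)) → a = c
  -- A unit can be inserted once more at the place of a unit; the derivation of the missing unit
  -- laws uses such auxiliary units.
  unit_self_right {f i : TermE L} {c : Word} : IsUnit i → Legit (f.ins c i) →
    ∃ e, Assoc c e c ∧ Legit (i.ins e i)
  unit_self_left {f i : TermE L} {b : Word} : IsUnit i → Legit (i.ins b f) →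
    Assoc b b b ∧ Legit (i.ins b i)
  -- arrows
  map (a : Word) {g g' f f' : TermE L} (v : g ⟶ g') (u : f ⟶ f') : g.ins a f ⟶ g'.ins a f'
  beta {b a c : Word} (p : Assoc b a c) (h g f : TermE L) :
    (h.ins b g).ins c f ≅ h.ins b (g.ins a f)
  theta {b a : Word} (p : Indep b a) (h g f : TermE L) :
    (h.ins b g).ins a f ⟶ (h.ins a f).ins b g
  mu {f i : TermE L} {a : Word} (hi : IsUnit i) (p : Legit (f.ins a i)) : f.ins a i ≅ f
  lam {f i : TermE L} {a : Word} (hi : IsUnit i) (p : Legit (i.ins a f)) : i.ins a f ≅ f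
  -- equations
  map_id (a : Word) (g f : TermE L) : map a (𝟙 g) (𝟙 f) = 𝟙 (g.ins a f)
  map_comp (a : Word) {g₁ g₂ g₃ f₁ f₂ f₃ : TermE L} (v₁ : g₁ ⟶ g₂) (v₂ : g₂ ⟶ g₃) (u₁ : f₁ ⟶ f₂)
    (u₂ : f₂ ⟶ f₃) : map a (v₁ ≫ v₂) (u₁ ≫ u₂) = map a v₁ u₁ ≫ map a v₂ u₂
  beta_nat {b a c : Word} (p : Assoc b a c) {h₁ h₂ g₁ g₂ f₁ f₂ : TermE L} (w : h₁ ⟶ h₂)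
    (v : g₁ ⟶ g₂) (u : f₁ ⟶ f₂) :
    map c (map b w v) u ≫ (beta p h₂ g₂ f₂).hom = (beta p h₁ g₁ f₁).hom ≫ map b w (map a v u)
  theta_nat {b a : Word} (p : Indep b a) {h₁ h₂ g₁ g₂ f₁ f₂ : TermE L} (w : h₁ ⟶ h₂)
    (v : g₁ ⟶ g₂) (u : f₁ ⟶ f₂) :
    map a (map b w v) u ≫ theta p h₂ g₂ f₂ = theta p h₁ g₁ f₁ ≫ map b (map a w u) v
  theta_theta {b a : Word} (p : Indep b a) (h g f : TermE L) :
    theta p h g f ≫ theta p.symm h f g = 𝟙 _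
  mu_nat {f₁ f₂ i : TermE L} {a : Word} (hi : IsUnit i) (p₁ : Legit (f₁.ins a i))
    (p₂ : Legit (f₂.ins a i)) (u : f₁ ⟶ f₂) :
    map a u (𝟙 i) ≫ (mu hi p₂).hom = (mu hi p₁).hom ≫ u
  lam_nat {f₁ f₂ i : TermE L} {a : Word} (hi : IsUnit i) (p₁ : Legit (i.ins a f₁))
    (p₂ : Legit (i.ins a f₂)) (u : f₁ ⟶ f₂) :
    map a (𝟙 i) u ≫ (lam hi p₂).hom = (lam hi p₁).hom ≫ u
  beta_pent {c b a cb ba cba : Word} (p₁ : Assoc b a ba) (p₂ : Assoc c ba cba)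
    (p₃ : Assoc c b cb) (p₄ : Assoc cb a cba) (j h g f : TermE L) :
    map cba (beta p₃ j h g).hom (𝟙 f) ≫ (beta p₂ j (h.ins b g) f).hom ≫
      map c (𝟙 j) (beta p₁ h g f).hom =
    (beta p₄ (j.ins c h) g f).hom ≫ (beta p₃ j h (g.ins a f)).hom
  theta_YB {c b a : Word} (p₁ : Indep c b) (p₂ : Indep c a) (p₃ : Indep b a) (j h g f : TermE L) :
    theta p₃ (j.ins c h) g f ≫ map b (theta p₂ j h f) (𝟙 g) ≫ theta p₁ (j.ins a f) h g =
    map a (theta p₁ j h g) (𝟙 f) ≫ theta p₂ (j.ins b g) h f ≫ map c (theta p₃ j g f) (𝟙 h)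
  beta_theta_one {c b a cb ca : Word} (p₁ : Indep b a) (p₂ : Assoc c a ca) (p₃ : Assoc c b cb)
    (p₄ : Indep cb ca) (j h g f : TermE L) :
    map ca (beta p₃ j h g).hom (𝟙 f) ≫ (beta p₂ j (h.ins b g) f).hom ≫
      map c (𝟙 j) (theta p₁ h g f) =
    theta p₄ (j.ins c h) g f ≫ map cb (beta p₂ j h f).hom (𝟙 g) ≫ (beta p₃ j (h.ins a f) g).hom
  beta_theta_two {c b a cb : Word} (p₁ : Indep c a) (p₂ : Assoc c b cb) (p₃ : Indep cb a)
    (j h g f : TermE L) :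
    map a (beta p₂ j h g).hom (𝟙 f) ≫ theta p₁ j (h.ins b g) f =
    theta p₃ (j.ins c h) g f ≫ map cb (theta p₁ j h f) (𝟙 g) ≫ (beta p₂ (j.ins a f) h g).hom
  beta_mu_lam {h i f : TermE L} {b a : Word} (hi : IsUnit i) (p : Assoc b a b)
    (q₁ : Legit (h.ins b i)) (q₂ : Legit (i.ins a f)) :
    (beta p h i f).hom ≫ map b (𝟙 h) (lam hi q₂).hom = map b (mu hi q₁).hom (𝟙 f)
  theta_mu {h i f : TermE L} {b a : Word} (hi : IsUnit i) (p : Indep b a)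
    (q₁ : Legit (h.ins b i)) (q₂ : Legit ((h.ins a f).ins b i)) :
    theta p h i f ≫ (mu hi q₂).hom = map a (mu hi q₁).hom (𝟙 f)

/-! ### Bifunctoriality of insertion and derived unit laws -/

namespace InsertionSystem

variable {L : Type u} [InsertionSystem L]

theorem map_comp_id (a : Word) {g₁ g₂ g₃ : TermE L} (f : TermE L) (v₁ : g₁ ⟶ g₂) (v₂ : g₂ ⟶ g₃) :
    map a (v₁ ≫ v₂) (𝟙 f) = map a v₁ (𝟙 f) ≫ map a v₂ (𝟙 f) := by
  rw [← map_comp, Category.comp_id]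

theorem map_id_comp (a : Word) {f₁ f₂ f₃ : TermE L} (g : TermE L) (u₁ : f₁ ⟶ f₂) (u₂ : f₂ ⟶ f₃) :
    map a (𝟙 g) (u₁ ≫ u₂) = map a (𝟙 g) u₁ ≫ map a (𝟙 g) u₂ := by
  rw [← map_comp, Category.comp_id]

theorem map_exchange (a : Word) {g g' f f' : TermE L} (v : g ⟶ g') (u : f ⟶ f') :
    map a v (𝟙 f) ≫ map a (𝟙 g') u = map a (𝟙 g) u ≫ map a v (𝟙 f') := by
  rw [← map_comp, ← map_comp, Category.comp_id, Category.comp_id, Category.id_comp,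
    Category.id_comp]

instance (a : Word) {g g' f f' : TermE L} (v : g ⟶ g') (u : f ⟶ f') [IsIso v] [IsIso u] :
    IsIso (map a v u) :=
  ⟨map a (inv v) (inv u), by simp [← map_comp, map_id], by simp [← map_comp, map_id]⟩

/-- By naturality, the isomorphism `μ` conjugates insertion of a unit into the identity functor, so
this insertion is faithful. -/
theorem map_mu_cancel {f₁ f₂ i : TermE L} {a : Word} (hi : IsUnit i) (p : Legit (f₁.ins a i))
    {u v : f₁ ⟶ f₂} (e : map a u (𝟙 i) = map a v (𝟙 i)) : u = v := by
  have p₂ : Legit (f₂.ins a i) := (legit_iff (map a u (𝟙 i))).1 p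
  rw [← cancel_epi (mu hi p).hom, ← mu_nat hi p p₂, ← mu_nat hi p p₂, e]

theorem map_lam_cancel {f₁ f₂ i : TermE L} {a : Word} (hi : IsUnit i) (p : Legit (i.ins a f₁))
    {u v : f₁ ⟶ f₂} (e : map a (𝟙 i) u = map a (𝟙 i) v) : u = v := by
  have p₂ : Legit (i.ins a f₂) := (legit_iff (map a (𝟙 i) u)).1 p
  rw [← cancel_epi (lam hi p).hom, ← lam_nat hi p p₂, ← lam_nat hi p p₂, e]

/-- Kelly's argument: it suffices to prove the equation after one more unit is inserted at `c`.
There the triangle law `beta_mu_lam` trades each `μ` for a `λ`, and the pentagon for `h`, `g` and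
two units compares the two sides. -/
theorem beta_comp_map_mu {h g i : TermE L} {b a c : Word} (hi : IsUnit i) (p : Assoc L b a c)
    (q₁ : Legit ((h.ins b g).ins c i)) (q₂ : Legit (g.ins a i)) :
    (beta p h g i).hom ≫ map b (𝟙 h) (mu hi q₂).hom = (mu hi q₁).hom := by
  obtain ⟨e, he, hl⟩ := unit_self_right hi q₁
  -- The second unit replaces the first one, so it occupies the same place `a` of `g`.
  obtain ⟨a', h₁, h₂⟩ := assoc_assoc p he
  obtain rfl := assoc_unique p h₂
  apply map_mu_cancel hi ((legit_iff (map c (mu hi q₁).hom (𝟙 i))).2 q₁)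
  rw [← cancel_mono (beta p h g i).hom, ← beta_mu_lam hi he q₁ hl, Category.assoc,
    ← map_id b h g, beta_nat, ← reassoc_of% beta_pent h₁ p p he h g i i,
    ← map_id_comp, beta_mu_lam hi h₁ q₂ hl, map_comp_id, Category.assoc, beta_nat]

/-- The mirror image of the preceding argument: everything is inserted in one more unit, and the
pentagon has two units on the left. -/
theorem beta_comp_lam {i g f : TermE L} {b c : Word} (hi : IsUnit i) (p : Assoc L b c c)
    (q₁ : Legit (i.ins b (g.ins c f))) (q₂ : Legit (i.ins b g)) :
    (beta p i g f).hom ≫ (lam hi q₁).hom = map c (lam hi q₂).hom (𝟙 f) := by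
  obtain ⟨hb, hl⟩ := unit_self_left hi q₁
  have q₃ : Legit (i.ins b ((i.ins b g).ins c f)) :=
    (legit_iff (map b (𝟙 i) ((beta p i g f).hom ≫ (lam hi q₁).hom))).2 q₁
  apply map_lam_cancel hi q₃
  rw [← cancel_epi (beta p i (i.ins b g) f).hom,
    ← cancel_epi (map c (beta hb i i g).hom (𝟙 f)), ← beta_nat, ← reassoc_of% map_comp_id,
    beta_mu_lam hi hb hl q₂, beta_nat, map_id, ← beta_mu_lam hi hb hl q₁,
    ← reassoc_of% beta_pent p p hb p i i g f, ← map_id_comp]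

/-- After insertion of another unit, the triangle law and `beta_comp_lam` present the two sides as
the same `β` followed by `map b (𝟙 i) λ` and by `λ` of `i.ins b i`. Naturality of `λ` with respect
to itself identifies these. -/
theorem mu_eq_lam {i : TermE L} {b : Word} (hi : IsUnit i) (p : Legit (i.ins b i)) :
    (mu hi p).hom = (lam hi p).hom := by
  obtain ⟨hb, -⟩ := unit_self_left hi p
  have q : Legit (i.ins b (i.ins b i)) := (legit_iff (map b (𝟙 i) (mu hi p).hom)).2 p
  apply map_mu_cancel hi ((legit_iff (map b (mu hi p).hom (𝟙 i))).2 p)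
  rw [← beta_mu_lam hi hb p p, ← beta_comp_lam hi hb q p]
  congr 1
  rw [← cancel_mono (lam hi p).hom, lam_nat hi q p]

theorem theta_comp_map_mu {h g i : TermE L} {b a : Word} (hi : IsUnit i) (p : Indep b a)
    (q₁ : Legit ((h.ins b g).ins a i)) (q₂ : Legit (h.ins a i)) :
    theta p h g i ≫ map b (mu hi q₂).hom (𝟙 g) = (mu hi q₁).hom := by
  rw [← theta_mu hi p.symm q₂ q₁, reassoc_of% theta_theta p]

/-! ### Rewriting -/

/-- The arrows that make one rewriting step. -/
inductive Step : ∀ {x y : TermE L}, (x ⟶ y) → Prop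
  | beta {b a c : Word} (p : Assoc L b a c) (h g f : TermE L) : Step (beta p h g f).hom
  | theta {b a : Word} (p : Indep b a) (hlt : a < b) (h g f : TermE L) : Step (theta p h g f)
  | mu {f i : TermE L} {a : Word} (hi : IsUnit i) (p : Legit (f.ins a i)) : Step (mu hi p).hom
  | lam {f i : TermE L} {a : Word} (hi : IsUnit i) (p : Legit (i.ins a f)) : Step (lam hi p).hom
  | left (a : Word) {g g' : TermE L} (f : TermE L) {v : g ⟶ g'} : Step v → Step (map a v (𝟙 f))
  | right (a : Word) (g : TermE L) {f f' : TermE L} {u : f ⟶ f'} : Step u → Step (map a (𝟙 g) u)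

/-- The composites of rewriting steps. -/
inductive Path : ∀ {x y : TermE L}, (x ⟶ y) → Prop
  | nil (x : TermE L) : Path (𝟙 x)
  | cons {x y z : TermE L} {u : x ⟶ y} {v : y ⟶ z} : Step u → Path v → Path (u ≫ v)

theorem Step.path {x y : TermE L} {u : x ⟶ y} (h : Step u) : Path u := by
  simpa using Path.cons h (.nil y)

theorem Path.comp {x y z : TermE L} {u : x ⟶ y} {v : y ⟶ z} (hu : Path u) (hv : Path v) :
    Path (u ≫ v) := by
  induction hu with
  | nil => simpa
  | cons hs _ ih => simpa using Path.cons hs (ih hv)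

theorem Path.map_left (a : Word) {g g' : TermE L} (f : TermE L) {v : g ⟶ g'} (h : Path v) :
    Path (map a v (𝟙 f)) := by
  induction h with
  | nil => rw [map_id]; exact .nil _
  | cons hs _ ih => rw [map_comp_id]; exact .cons (.left a f hs) ih

theorem Path.map_right (a : Word) (g : TermE L) {f f' : TermE L} {u : f ⟶ f'} (h : Path u) :
    Path (map a (𝟙 g) u) := by
  induction h with
  | nil => rw [map_id]; exact .nil _
  | cons hs _ ih => rw [map_id_comp]; exact .cons (.right a g hs) ih

/-- Two arrows with the same source that are completed by paths to a commuting square. -/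
def Join {x y z : TermE L} (u : x ⟶ y) (v : x ⟶ z) : Prop :=
  ∃ (w : TermE L) (p : y ⟶ w) (q : z ⟶ w), Path p ∧ Path q ∧ u ≫ p = v ≫ q

theorem Join.symm {x y z : TermE L} {u : x ⟶ y} {v : x ⟶ z} (h : Join u v) : Join v u :=
  let ⟨w, p, q, hp, hq, e⟩ := h
  ⟨w, q, p, hq, hp, e.symm⟩

theorem Join.refl {x y : TermE L} (u : x ⟶ y) : Join u u := ⟨y, 𝟙 y, 𝟙 y, .nil _, .nil _, rfl⟩

/-- The source of every step is an insertion. -/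
theorem not_step_of_isUnit {i y : TermE L} (hi : IsUnit i) {u : i ⟶ y} : ¬ Step u := by
  intro h
  cases h <;> exact unit_ne_ins hi

/-! ### Measures of terms -/

section Measures

variable {L : Type u}

/-- A weight that `θ` preserves and that the other rewriting steps decrease. -/
def weight : TermE L → ℕ
  | .gen _ => 1
  | .unit => 1
  | .ins g _ f => weight g * (weight f + 1)

/-- The number of places greater than `a` among those of the successive insertions that make a
term. -/
def placesAbove (a : Word) : TermE L → ℕ
  | .gen _ => 0
  | .unit => 0
  | .ins g b _ => placesAbove a g + if a < b then 1 else 0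

/-- The number of pairs of insertions that are not made in the increasing order of places. -/
def inversions : TermE L → ℕ
  | .gen _ => 0
  | .unit => 0
  | .ins g a f => inversions g + inversions f + placesAbove a g

theorem weight_pos (x : TermE L) : 0 < weight x := by
  induction x with
  | gen | unit => exact Nat.one_pos
  | ins g a f ihg ihf => exact Nat.mul_pos ihg (Nat.succ_pos _)

end Measures

variable {L : Type u} [InsertionSystem L]

/-! ### Local confluence -/

instance {b a : Word} (p : Indep b a) (h g f : TermE L) : IsIso (theta p h g f) :=
  ⟨theta p.symm h f g, theta_theta p h g f, theta_theta p.symm h f g⟩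

/-- Steps within `h`, `g` or `f` are handled by naturality. The overlap with another `β` is the
pentagon, that with an inner `θ` is `beta_theta_two`, and each position of a unit has its own unit
law. A `θ` at the root is impossible, as `b` is a prefix of `c`. -/
theorem join_beta {h g f z : TermE L} {b a c : Word} (p : Assoc L b a c)
    (q : Legit ((h.ins b g).ins c f)) {v : (h.ins b g).ins c f ⟶ z} (hv : Step v) :
    Join (beta p h g f).hom v := by
  have q' : Legit (h.ins b (g.ins a f)) := (legit_iff (beta p h g f).hom).1 q
  cases hv with
  | beta p' =>
    obtain rfl := assoc_unique p p'
    exact .refl _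
  | theta p' => exact absurd (assoc_prefix p) p'.1
  | mu hi p' =>
    exact ⟨_, _, _, .map_right b h (Step.mu hi (legit_right q')).path, .nil _,
      (beta_comp_map_mu hi p p' _).trans (Category.comp_id _).symm⟩
  | lam hi => exact absurd hi unit_ne_ins
  | right _ _ hu =>
    refine ⟨_, _, _, ((hu.right a g).right b h).path, (Step.beta p h g _).path, ?_⟩
    rw [← beta_nat, map_id]
  | left _ _ hu =>
    cases hu with
    | @left _ _ h' _ w hw =>
      refine ⟨_, _, _, (hw.left b (g.ins a f)).path, (Step.beta p h' g f).path, ?_⟩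
      rw [beta_nat, map_id]
    | @right _ _ _ g' w hw =>
      exact ⟨_, _, _, ((hw.left a f).right b h).path, (Step.beta p h g' f).path,
        (beta_nat p _ _ _).symm⟩
    | mu hi p' =>
      obtain rfl := unit_assoc_right hi p q'
      exact ⟨_, _, _, ((Step.lam hi (legit_right q')).right c h).path, .nil _,
        (beta_mu_lam hi p p' _).trans (Category.comp_id _).symm⟩
    | lam hi p' =>
      obtain rfl := unit_assoc_left hi p q'
      exact ⟨_, _, _, (Step.lam hi q').path, .nil _,
        (beta_comp_lam hi p q' p').trans (Category.comp_id _).symm⟩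
    | @beta c' b' _ p' j h _ =>
      obtain ⟨ba, h₁, h₂⟩ := assoc_assoc p' p
      exact ⟨_, _, _, (Step.beta p' j h _).path,
        (Step.beta h₂ _ _ _).path.comp ((Step.beta h₁ _ _ _).right _ _).path,
        (beta_pent h₁ h₂ p' p j h g f).symm⟩
    | @theta d _ p' hlt j k _ =>
      have hp := assoc_prefix p
      have hd : Indep d c := p'.prefix_right hp
      refine ⟨_, _, _, (Step.theta p' hlt j k _).path,
        (Step.theta hd ((p'.lt_of_prefix hp).2 hlt) _ k f).path.comp
          ((Step.beta p j g f).left d k).path, ?_⟩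
      -- The axiom moves `k` in the direction opposite to the rewriting, so the three occurrences of
      -- `θ` are replaced by their inverses.
      have e := beta_theta_two p'.symm p hd.symm j g f k
      have e₂ := reassoc_of% theta_theta hd (j.ins b g) k f
      have e₃ : map c (theta p' j k g) (𝟙 f) ≫ map c (theta p'.symm j g k) (𝟙 f) = 𝟙 _ := by
        rw [← map_comp_id, theta_theta, map_id]
      rw [← cancel_mono (theta p'.symm j (g.ins a f) k), Category.assoc, theta_theta,
        Category.comp_id, Category.assoc, Category.assoc, e, e₂, reassoc_of% e₃]

/-- Overlaps with an inner `β` are closed by one of the two mixed equations, and those with an inner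
`θ` by the Yang–Baxter equation. A unit cannot receive both insertions, since it has a single place.
-/
theorem join_theta {h g f z : TermE L} {b a : Word} (p : Indep b a) (hlt : a < b)
    (q : Legit ((h.ins b g).ins a f)) {v : (h.ins b g).ins a f ⟶ z} (hv : Step v) :
    Join (theta p h g f) v := by
  have q' : Legit ((h.ins a f).ins b g) := (legit_iff (theta p h g f)).1 q
  cases hv with
  | beta p' => exact absurd (assoc_prefix p') p.1
  | theta p' => exact .refl _
  | mu hi p' =>
    exact ⟨_, _, _, .map_left b g (Step.mu hi (legit_left q')).path, .nil _,
      (theta_comp_map_mu hi p p' _).trans (Category.comp_id _).symm⟩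
  | lam hi => exact absurd hi unit_ne_ins
  | @right _ _ _ f' u hu =>
    refine ⟨_, _, _, ((hu.right a h).left b g).path, (Step.theta p hlt h g f').path, ?_⟩
    rw [← theta_nat, map_id]
  | left _ _ hu =>
    cases hu with
    | @left _ _ h' _ w hw =>
      exact ⟨_, _, _, ((hw.left a f).left b g).path, (Step.theta p hlt h' g f).path,
        (theta_nat p _ _ _).symm⟩
    | @right _ _ _ g' w hw =>
      refine ⟨_, _, _, (hw.right b (h.ins a f)).path, (Step.theta p hlt h g' f).path, ?_⟩
      rw [theta_nat, map_id]
    | mu hi p' =>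
      exact ⟨_, _, _, (Step.mu hi q').path, .nil _,
        (theta_mu hi p p' q').trans (Category.comp_id _).symm⟩
    | lam hi p' => exact absurd (unit_place hi p' (legit_left q')) p.ne
    | @beta c b' _ p' j k _ =>
      -- Here `f` goes either outside `k`, passing it by `θ`, or into `k`, by `β` followed by a `θ`
      -- inside.
      rcases assoc_split p' p hlt with ⟨h₁, h₂⟩ | ⟨a', h₁, h₂, h₃⟩
      · exact ⟨_, _, _, ((Step.theta h₁ h₂ j k f).left b g).path.comp (Step.beta p' _ k g).path,
          (Step.theta h₁ h₂ j (k.ins b' g) f).path, (beta_theta_two h₁ p' p j k g f).symm⟩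
      · exact ⟨_, _, _,
          ((Step.beta h₁ j k f).left b g).path.comp (Step.beta p' j (k.ins a' f) g).path,
          (Step.beta h₁ j (k.ins b' g) f).path.comp ((Step.theta h₂ h₃ k g f).right c j).path,
          (beta_theta_one h₂ h₁ p' p j k g f).symm⟩
    | @theta c _ p' hlt' j k _ =>
      -- The places satisfy `a < b < c`, with only neighbours known to be independent. Both sides of
      -- the hexagon sort them, and this needs `a` and `c` independent too.
      have hc : Indep c a := (p.symm.trans_lt p'.symm hlt hlt').symm
      have hac : a < c := hlt.trans hlt'
      exact ⟨_, _, _,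
        ((Step.theta hc hac j k f).left b g).path.comp (Step.theta p' hlt' (j.ins a f) k g).path,
        (Step.theta hc hac (j.ins b g) k f).path.comp ((Step.theta p hlt j g f).left c k).path,
        theta_YB p' hc p j k g f⟩

theorem join_mu {f i z : TermE L} {a : Word} (hi : IsUnit i) (p : Legit (f.ins a i))
    {v : f.ins a i ⟶ z} (hv : Step v) : Join (mu hi p).hom v := by
  cases hv with
  | beta p' => exact (join_beta p' p (.mu hi p)).symm
  | theta p' hlt => exact (join_theta p' hlt p (.mu hi p)).symm
  | mu => exact .refl _
  | lam hi' =>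
    -- A unit inserted in a unit can be removed by `μ` or by `λ`, and these two arrows coincide.
    obtain rfl := unit_unit hi' hi p
    rw [mu_eq_lam]
    exact .refl _
  | @left _ _ f' _ u hu =>
    have p' : Legit (f'.ins a i) := (legit_iff (map a u (𝟙 i))).1 p
    exact ⟨_, _, _, hu.path, (Step.mu hi p').path, (mu_nat hi p p' u).symm⟩
  | right _ _ hu => exact absurd hu (not_step_of_isUnit hi)

theorem join_lam {f i z : TermE L} {a : Word} (hi : IsUnit i) (p : Legit (i.ins a f))
    {v : i.ins a f ⟶ z} (hv : Step v) : Join (lam hi p).hom v := by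
  cases hv with
  | beta p' => exact (join_beta p' p (.lam hi p)).symm
  | theta p' hlt => exact (join_theta p' hlt p (.lam hi p)).symm
  | mu hi' p' => exact (join_mu hi' p' (.lam hi p)).symm
  | lam => exact .refl _
  | left _ _ hu => exact absurd hu (not_step_of_isUnit hi)
  | @right _ _ _ f' u hu =>
    have p' : Legit (i.ins a f') := (legit_iff (map a (𝟙 i) u)).1 p
    exact ⟨_, _, _, hu.path, (Step.lam hi p').path, (lam_nat hi p p' u).symm⟩

/-- Induction on the context of the first step. If either step is at the root, an earlier lemma
applies; steps in different arguments commute by bifunctoriality; steps in the same argument are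
joined there. -/
theorem join_of_step {x y z : TermE L} (q : Legit x) {u : x ⟶ y} {v : x ⟶ z} (hu : Step u)
    (hv : Step v) : Join u v := by
  induction hu generalizing z with
  | beta p => exact join_beta p q hv
  | theta p hlt => exact join_theta p hlt q hv
  | mu hi p => exact join_mu hi p hv
  | lam hi p => exact join_lam hi p hv
  | left a f hu ih =>
    cases hv with
    | beta p => exact (join_beta p q (.left _ _ hu)).symm
    | theta p hlt => exact (join_theta p hlt q (.left _ _ hu)).symm
    | mu hi p => exact (join_mu hi p (.left _ _ hu)).symm
    | lam hi p => exact (join_lam hi p (.left _ _ hu)).symm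
    | left _ _ hv =>
      obtain ⟨w, r, s, hr, hs, e⟩ := ih (legit_left q) hv
      refine ⟨_, _, _, hr.map_left a f, hs.map_left a f, ?_⟩
      rw [← map_comp_id, ← map_comp_id, e]
    | right _ _ hv =>
      exact ⟨_, _, _, (hv.right a _).path, (hu.left a _).path, map_exchange _ _ _⟩
  | right a g hu ih =>
    cases hv with
    | beta p => exact (join_beta p q (.right _ _ hu)).symm
    | theta p hlt => exact (join_theta p hlt q (.right _ _ hu)).symm
    | mu hi p => exact (join_mu hi p (.right _ _ hu)).symm
    | lam hi p => exact (join_lam hi p (.right _ _ hu)).symm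
    | left _ _ hv =>
      exact ⟨_, _, _, (hv.left a _).path, (hu.right a _).path, (map_exchange _ _ _).symm⟩
    | right _ _ hv =>
      obtain ⟨w, r, s, hr, hs, e⟩ := ih (legit_right q) hv
      refine ⟨_, _, _, hr.map_right a g, hs.map_right a g, ?_⟩
      rw [← map_id_comp, ← map_id_comp, e]

/-! ### Termination -/

/-- The clause on `placesAbove` makes the induction work: the inversions of `g.ins a f` involve the
places in `g`, so a step in `g` must leave their counts unchanged when it keeps the weight. -/
theorem Step.decreases {x y : TermE L} {u : x ⟶ y} (hu : Step u) :
    weight y < weight x ∨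
      weight y = weight x ∧ inversions y < inversions x ∧
        ∀ a, placesAbove a y = placesAbove a x := by
  induction hu with
  | beta p h g f =>
    left
    have := weight_pos h
    have := weight_pos f
    simp only [weight]
    rw [mul_assoc]
    refine Nat.mul_lt_mul_of_pos_left ?_ ‹_›
    -- Without the factor `weight h`, the two sides differ by exactly `weight f`.
    nlinarith
  | theta p hlt h g f =>
    right
    refine ⟨by simp only [weight]; ring, ?_, fun a => ?_⟩
    -- Exactly one inversion disappears, that of the two exchanged insertions.
    · simp only [inversions, placesAbove, hlt, lt_asymm hlt, if_true, if_false]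
      omega
    · simp only [placesAbove]
      omega
  | @mu f i a hi p =>
    left
    simp only [weight]
    nlinarith [weight_pos f, weight_pos i]
  | @lam f i a hi p =>
    left
    simp only [weight]
    nlinarith [weight_pos f, weight_pos i]
  | left a f hu ih =>
    rcases ih with h | ⟨h₁, h₂, h₃⟩
    · exact .inl (Nat.mul_lt_mul_of_pos_right h (Nat.succ_pos _))
    · refine .inr ⟨by simp only [weight, h₁], ?_, fun c => by simp only [placesAbove, h₃]⟩
      simp only [inversions, h₃]
      omega
  | right a g hu ih =>
    rcases ih with h | ⟨h₁, h₂, h₃⟩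
    · exact .inl (Nat.mul_lt_mul_of_pos_left (Nat.succ_lt_succ h) (weight_pos g))
    · refine .inr ⟨by simp only [weight, h₁], ?_, fun c => by simp only [placesAbove]⟩
      simp only [inversions]
      omega

theorem wellFounded_step : WellFounded fun y x : TermE L => ∃ u : x ⟶ y, Step u := by
  refine Subrelation.wf (r := InvImage (Prod.Lex (· < ·) (· < ·))
    fun x : TermE L => (weight x, inversions x)) ?_
    (InvImage.wf _ (WellFounded.prod_lex wellFounded_lt wellFounded_lt))
  rintro y x ⟨u, hu⟩
  rcases hu.decreases with h | ⟨h₁, h₂, -⟩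
  · exact .left _ _ h
  · change Prod.Lex _ _ (weight y, inversions y) (weight x, inversions x)
    rw [h₁]
    exact .right _ h₂

/-! ### Confluence and coherence -/

theorem Path.isIso {x y : TermE L} {u : x ⟶ y} (hu : Path u) : IsIso u := by
  have step {x y : TermE L} {u : x ⟶ y} (hu : Step u) : IsIso u := by
    induction hu <;> infer_instance
  induction hu with
  | nil => infer_instance
  | cons hs _ ih =>
    have := step hs
    infer_instance

/-- Newman's lemma with commuting diagrams: the first steps are joined locally, and the induction
hypothesis at their targets pastes two more squares. -/
theorem join_of_path {x y z : TermE L} (q : Legit x) {u : x ⟶ y} {v : x ⟶ z} (hu : Path u)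
    (hv : Path v) : Join u v := by
  induction x using (wellFounded_step (L := L)).induction generalizing y z with
  | _ x ih =>
    cases hu with
    | nil => exact ⟨_, _, _, hv, .nil _, by simp⟩
    | cons hs hu =>
      rename_i y₁ s u
      cases hv with
      | nil => exact ⟨_, _, _, .nil _, .cons hs hu, by simp⟩
      | cons ht hv =>
        rename_i z₁ t v
        obtain ⟨w, p, r, hp, hr, e⟩ := join_of_step q hs ht
        obtain ⟨w₁, p₁, r₁, hp₁, hr₁, e₁⟩ := ih y₁ ⟨s, hs⟩ ((legit_iff s).1 q) hu hp
        obtain ⟨w₂, p₂, r₂, hp₂, hr₂, e₂⟩ :=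
          ih z₁ ⟨t, ht⟩ ((legit_iff t).1 q) hv (hr.comp hr₁)
        refine ⟨_, _, _, hp₁.comp hr₂, hp₂, ?_⟩
        rw [Category.assoc, Category.assoc, e₂, reassoc_of% e₁, reassoc_of% e, Category.assoc]

theorem exists_path_normal (x : TermE L) :
    ∃ (n : TermE L) (u : x ⟶ n), Path u ∧ ∀ (y : TermE L) (v : n ⟶ y), ¬ Step v := by
  induction x using (wellFounded_step (L := L)).induction with
  | _ x ih =>
    by_cases hx : ∃ (y : TermE L) (v : x ⟶ y), Step v
    · obtain ⟨y, v, hv⟩ := hx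
      obtain ⟨n, u, hu, hn⟩ := ih y ⟨v, hv⟩
      exact ⟨n, _, .cons hv hu, hn⟩
    · push Not at hx
      exact ⟨x, 𝟙 x, .nil x, hx⟩

/-- Confluence only equalizes parallel paths after further rewriting. Once they are continued by `r`
to a normal form, no rewriting is left, and the isomorphism `r` is cancelled. -/
theorem Path.eq {x y : TermE L} (q : Legit x) {u v : x ⟶ y} (hu : Path u) (hv : Path v) :
    u = v := by
  obtain ⟨n, r, hr, hn⟩ := exists_path_normal y
  obtain ⟨w, p₁, p₂, hp₁, hp₂, e⟩ := join_of_path q (hu.comp hr) (hv.comp hr)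
  have := hr.isIso
  cases hp₁ with
  | cons hs => exact absurd hs (hn _ _)
  | nil =>
    cases hp₂ with
    | cons hs => exact absurd hs (hn _ _)
    | nil => simpa [cancel_mono] using e

/-- The arrows that are completed by two paths to a commuting triangle. -/
def Reducible {x y : TermE L} (u : x ⟶ y) : Prop :=
  Legit x → ∃ (z : TermE L) (p : x ⟶ z) (q : y ⟶ z), Path p ∧ Path q ∧ u ≫ q = p

theorem Path.reducible {x y : TermE L} {u : x ⟶ y} (hu : Path u) : Reducible u :=
  fun _ => ⟨y, u, 𝟙 y, hu, .nil y, Category.comp_id u⟩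

theorem Step.reducible {x y : TermE L} {u : x ⟶ y} (hu : Step u) : Reducible u :=
  hu.path.reducible

theorem Step.reducible_inv {x y : TermE L} {u : x ≅ y} (hu : Step u.hom) : Reducible u.inv :=
  fun _ => ⟨y, 𝟙 y, u.hom, .nil y, hu.path, u.inv_hom_id⟩

/-- Against the order of places, `θ` is the inverse of a step. -/
theorem reducible_theta {b a : Word} (p : Indep b a) (h g f : TermE L) :
    Reducible (theta p h g f) := by
  rcases lt_or_gt_of_ne p.ne with hlt | hlt
  · exact fun _ => ⟨_, 𝟙 _, theta p.symm h f g, .nil _, (Step.theta p.symm hlt h f g).path,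
      theta_theta p h g f⟩
  · exact (Step.theta p hlt h g f).reducible

/-- The path that ends the first triangle and the one that is a side of the second both start at
`y`; confluence joins them. -/
theorem Reducible.comp {x y z : TermE L} {u : x ⟶ y} {v : y ⟶ z} (hu : Reducible u)
    (hv : Reducible v) : Reducible (u ≫ v) := by
  intro q
  have qy := (legit_iff u).1 q
  obtain ⟨m, p, r, hp, hr, rfl⟩ := hu q
  obtain ⟨n, s, t, hs, ht, rfl⟩ := hv qy
  obtain ⟨w, k, l, hk, hl, e⟩ := join_of_path qy hr hs
  refine ⟨w, _, _, hp.comp hk, ht.comp hl, ?_⟩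
  simp only [Category.assoc] at e ⊢
  rw [e]

theorem Reducible.map (a : Word) {g g' f f' : TermE L} {v : g ⟶ g'} {u : f ⟶ f'}
    (hv : Reducible v) (hu : Reducible u) : Reducible (map a v u) := by
  intro q
  obtain ⟨m, p, r, hp, hr, rfl⟩ := hv (legit_left q)
  obtain ⟨n, s, t, hs, ht, rfl⟩ := hu (legit_right q)
  refine ⟨_, _, _, (hp.map_left a f).comp (hs.map_right a m),
    (hr.map_left a f').comp (ht.map_right a m), ?_⟩
  simp only [← map_comp, Category.id_comp, Category.comp_id]

/-- Joining the two closing paths at `y` turns `u` and `v` into parallel paths out of `x`, which are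
equal; the common closing path is an isomorphism and cancels. -/
theorem Reducible.eq {x y : TermE L} (q : Legit x) {u v : x ⟶ y} (hu : Reducible u)
    (hv : Reducible v) : u = v := by
  obtain ⟨m, p, r, hp, hr, rfl⟩ := hu q
  obtain ⟨n, s, t, hs, ht, rfl⟩ := hv q
  obtain ⟨w, k, l, hk, hl, e⟩ := join_of_path ((legit_iff u).1 q) hr ht
  have := (hr.comp hk).isIso
  have h := (hp.comp hk).eq q (hs.comp hl)
  rwa [Category.assoc, Category.assoc, ← e, cancel_mono] at h

end InsertionSystem

theorem genArity_prefix_free {n : ℕ} {w w' : Word} (hw : w ∈ genArity n) (hw' : w' ∈ genArity n)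
    (h : w <+: w') : w = w' := by
  unfold genArity at hw hw'
  split_ifs at hw hw'
  · exact hw.trans hw'.symm
  · obtain ⟨k, -, rfl⟩ := hw
    obtain ⟨l, -, rfl⟩ := hw'
    simpa using h

/-! ### Terms indexed by places -/

namespace TermE

variable {G : Type u} {α : G → ℕ}

theorem mem_s_ins {g f : TermE G} {a w : Word} :
    w ∈ (g.ins a f).s α ↔ (w ∈ g.s α ∧ w ≠ a) ∨ ∃ b ∈ f.s α, w = a ++ b :=
  Iff.rfl

/-- A place `w` left over from `g` that is comparable with a new place, which extends `a`, is
comparable with `a` itself. By induction it equals `a`, which was removed. This turns the proviso of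
`θ` into independence of places. -/
theorem Legit.prefix_free {f : TermE G} (hf : f.Legit α) {w w' : Word} (hw : w ∈ f.s α)
    (hw' : w' ∈ f.s α) (h : w <+: w') : w = w' := by
  induction f generalizing w w' with
  | gen x => exact genArity_prefix_free hw hw' h
  | unit => exact Eq.trans hw hw'.symm
  | ins g a f ihg ihf =>
    obtain ⟨hg, hf, ha⟩ := hf
    rcases hw with ⟨hw, hwa⟩ | ⟨b, hb, rfl⟩ <;> rcases hw' with ⟨hw', hwa'⟩ | ⟨b', hb', rfl⟩
    · exact ihg hg hw hw' h
    · rcases List.prefix_or_prefix_of_prefix h (List.prefix_append a b') with h' | h'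
      · exact absurd (ihg hg hw ha h') hwa
      · exact absurd (ihg hg ha hw h').symm hwa
    · exact absurd (ihg hg ha hw' ((List.prefix_append a b).trans h)).symm hwa'
    · rw [ihf hf hb hb' (by simpa using h)]

theorem Legit.indep {f : TermE G} (hf : f.Legit α) {a b : Word} (ha : a ∈ f.s α) (hb : b ∈ f.s α)
    (hne : a ≠ b) : Indep a b :=
  ⟨fun h => hne (hf.prefix_free ha hb h), fun h => hne (hf.prefix_free hb ha h).symm⟩

/-- Otherwise `b ++ a` would be a place of `h` other than `b` and extending it. -/
theorem mem_of_legit_beta {h g f : TermE G} {b a : Word}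
    (p : ((h.ins b g).ins (b ++ a) f).Legit α) : a ∈ g.s α := by
  obtain ⟨⟨hh, hg, hb⟩, hf, ⟨hc, hne⟩ | ⟨a', ha', e⟩⟩ := p
  · exact absurd (hh.prefix_free hb hc (List.prefix_append b a)).symm hne
  · rwa [List.append_cancel_left e]

theorem legit_beta_iff (h g f : TermE G) (b a : Word) :
    ((h.ins b g).ins (b ++ a) f).Legit α ↔ (h.ins b (g.ins a f)).Legit α := by
  constructor
  · intro p
    exact ⟨p.1.1, ⟨p.1.2.1, p.2.1, mem_of_legit_beta p⟩, p.1.2.2⟩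
  · rintro ⟨hh, ⟨hg, hf, ha⟩, hb⟩
    exact ⟨⟨hh, hg, hb⟩, hf, .inr ⟨a, ha, rfl⟩⟩

theorem legit_theta {h g f : TermE G} {b a : Word} (hba : Indep b a)
    (p : ((h.ins b g).ins a f).Legit α) : ((h.ins a f).ins b g).Legit α := by
  obtain ⟨⟨hh, hg, hb⟩, hf, ⟨ha, hne⟩ | ⟨a', ha', e⟩⟩ := p
  · exact ⟨⟨hh, hf, ha⟩, hg, .inl ⟨hb, hba.ne⟩⟩
  · exact absurd ⟨a', e.symm⟩ hba.1

theorem legit_theta_iff (h g f : TermE G) {b a : Word} (hba : Indep b a) :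
    ((h.ins b g).ins a f).Legit α ↔ ((h.ins a f).ins b g).Legit α :=
  ⟨legit_theta hba, legit_theta hba.symm⟩

theorem s_beta {h g f : TermE G} {b a : Word} (p : ((h.ins b g).ins (b ++ a) f).Legit α) :
    ((h.ins b g).ins (b ++ a) f).s α = (h.ins b (g.ins a f)).s α := by
  obtain ⟨⟨hh, hg, hb⟩, hf, -⟩ := p
  ext w
  simp only [mem_s_ins]
  constructor
  · rintro (⟨⟨hw, hwb⟩ | ⟨d, hd, rfl⟩, hwa⟩ | ⟨d, hd, rfl⟩)
    · exact .inl ⟨hw, hwb⟩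
    · exact .inr ⟨d, .inl ⟨hd, fun e => hwa (e ▸ rfl)⟩, rfl⟩
    · exact .inr ⟨a ++ d, .inr ⟨d, hd, rfl⟩, List.append_assoc _ _ _⟩
  · rintro (⟨hw, hwb⟩ | ⟨_, ⟨hd, hda⟩ | ⟨d, hd, rfl⟩, rfl⟩)
    · refine .inl ⟨.inl ⟨hw, hwb⟩, ?_⟩
      rintro rfl
      exact hwb (hh.prefix_free hb hw (List.prefix_append b a)).symm
    · exact .inl ⟨.inr ⟨_, hd, rfl⟩, fun e => hda (List.append_cancel_left e)⟩
    · exact .inr ⟨d, hd, (List.append_assoc _ _ _).symm⟩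

theorem s_theta_subset (h g f : TermE G) {b a : Word} (hba : Indep b a) :
    ((h.ins b g).ins a f).s α ⊆ ((h.ins a f).ins b g).s α := by
  rintro w (⟨⟨hw, hwb⟩ | ⟨d, hd, rfl⟩, hwa⟩ | ⟨d, hd, rfl⟩)
  · exact .inl ⟨.inl ⟨hw, hwa⟩, hwb⟩
  · exact .inr ⟨d, hd, rfl⟩
  · exact .inl ⟨.inr ⟨d, hd, rfl⟩, fun e => hba.2 ⟨d, e⟩⟩

theorem s_theta (h g f : TermE G) {b a : Word} (hba : Indep b a) :
    ((h.ins b g).ins a f).s α = ((h.ins a f).ins b g).s α :=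
  (s_theta_subset h g f hba).antisymm (s_theta_subset h f g hba.symm)

theorem s_mu {f : TermE G} {a : Word} (p : (f.ins a .unit).Legit α) :
    (f.ins a .unit).s α = f.s α := by
  ext w
  simp only [mem_s_ins]
  constructor
  · rintro (⟨hw, -⟩ | ⟨_, rfl, rfl⟩)
    · exact hw
    · simpa using p.2.2
  · intro hw
    by_cases e : w = a
    · exact .inr ⟨[], rfl, by simpa using e⟩
    · exact .inl ⟨hw, e⟩

theorem s_lam (f : TermE G) : (TermE.unit.ins [] f).s α = f.s α := by
  ext w
  simp only [mem_s_ins]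
  constructor
  · rintro (⟨hw, hne⟩ | ⟨b, hb, rfl⟩)
    · exact absurd hw hne
    · exact hb
  · exact fun hw => .inr ⟨w, hw, rfl⟩

end TermE

theorem ThetaE.indep {G : Type u} {α : G → ℕ} {h g f : TermE G} {b a : Word}
    (p : ThetaE α h b g a f) : Indep b a :=
  p.left.1.1.indep p.left.1.2.2 p.right.1.2.2 p.ne.symm

namespace ArrowE

variable {G : Type u} {α : G → ℕ}

theorem legit {f g : TermE G} (u : ArrowE α f g) : f.Legit α ∧ g.Legit α := by
  induction u with
  | id f p => exact ⟨p, p⟩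
  | beta h b g a f c p => exact ⟨p.left, p.right⟩
  | betaInv h b g a f c p => exact ⟨p.right, p.left⟩
  | theta h b g a f p => exact ⟨p.left, p.right⟩
  | mu f a p => exact ⟨p, p.1⟩
  | muInv f a p => exact ⟨p.1, p⟩
  | lam f p => exact ⟨⟨trivial, p, rfl⟩, p⟩
  | lamInv f p => exact ⟨p, ⟨trivial, p, rfl⟩⟩
  | comp v u ihv ihu => exact ⟨ihu.1, ihv.2⟩
  | ins a v u p p' => exact ⟨p, p'⟩

/-- This makes legitimacy of an insertion invariant under arrows between its arguments. -/
theorem s_eq {f g : TermE G} (u : ArrowE α f g) : f.s α = g.s α := by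
  induction u with
  | id f p => rfl
  | beta h b g a f c p =>
    obtain ⟨rfl, p, -⟩ := p
    exact TermE.s_beta p
  | betaInv h b g a f c p =>
    obtain ⟨rfl, p, -⟩ := p
    exact (TermE.s_beta p).symm
  | theta h b g a f p => exact TermE.s_theta h g f p.indep
  | mu f a p => exact TermE.s_mu p
  | muInv f a p => exact (TermE.s_mu p).symm
  | lam f p => exact TermE.s_lam f
  | lamInv f p => exact (TermE.s_lam f).symm
  | comp v u ihv ihu => exact ihu.trans ihv
  | ins a v u p p' ihv ihu => simp only [TermE.s, ihv, ihu]

/-- Arrow terms up to the equations. -/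
abbrev Class (α : G → ℕ) (f g : TermE G) : Type u := Quotient (ArrowE.setoid α f g)

/-- The arrow of an arrow term. -/
abbrev toClass {f g : TermE G} (u : ArrowE α f g) : Class α f g := Quotient.mk _ u

theorem toClass_eq {f g : TermE G} {u v : ArrowE α f g} (h : Equ u v) : u.toClass = v.toClass :=
  Quotient.sound h

namespace Class

/-- Composition of arrows, in diagrammatic order. -/
def comp {f g h : TermE G} (u : Class α f g) (v : Class α g h) : Class α f h :=
  Quotient.map₂ (fun u v => ArrowE.comp v u) (fun _ _ hu _ _ hv => Equ.comp_congr hu hv) u v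

/-- Insertion of arrows. -/
def ins (a : Word) {g g' f f' : TermE G} (v : Class α g g') (u : Class α f f')
    (p : (g.ins a f).Legit α) (p' : (g'.ins a f').Legit α) : Class α (g.ins a f) (g'.ins a f') :=
  Quotient.map₂ (fun v u => ArrowE.ins a v u p p')
    (fun _ _ hv _ _ hu => Equ.ins_congr a p p' hu hv) v u

theorem s_eq {f g : TermE G} (u : Class α f g) : f.s α = g.s α :=
  Quotient.inductionOn u ArrowE.s_eq

end Class

end ArrowE

/-! ### The category of terms indexed by places as an insertion system -/

/-- The arrows between expressions: a source and a target that are both legitimate or both not,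
and an arrow in the first case. -/
@[ext]
structure HomE {G : Type u} (α : G → ℕ) (f g : TermE G) : Type u where
  legit_iff : f.Legit α ↔ g.Legit α
  arr : f.Legit α → ArrowE.Class α f g

namespace HomE

variable {G : Type u} {α : G → ℕ}

/-- The arrow of an arrow term. -/
def mk' {f g : TermE G} (u : ArrowE α f g) : HomE α f g :=
  ⟨⟨fun _ => u.legit.2, fun _ => u.legit.1⟩, fun _ => u.toClass⟩

/-- Identity arrows. -/
def id (f : TermE G) : HomE α f f := ⟨Iff.rfl, fun p => (ArrowE.id f p).toClass⟩

/-- Composition of arrows, in diagrammatic order. -/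
def comp {f g h : TermE G} (u : HomE α f g) (v : HomE α g h) : HomE α f h :=
  ⟨u.legit_iff.trans v.legit_iff, fun p => (u.arr p).comp (v.arr (u.legit_iff.1 p))⟩

/-- Expressions as a category. -/
abbrev category (α : G → ℕ) : Category.{u} (TermE G) where
  Hom f g := HomE α f g
  id f := id f
  comp u v := comp u v
  id_comp {f g} u := HomE.ext (funext fun p => by
    have (u' : ArrowE.Class α f g) : (ArrowE.id _ p).toClass.comp u' = u' := by
      induction u' using Quotient.inductionOn
      exact ArrowE.toClass_eq (.comp_id _ p)
    exact this _)
  comp_id {f g} u := HomE.ext (funext fun p => by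
    have (u' : ArrowE.Class α f g) : u'.comp (ArrowE.id _ (u.legit_iff.1 p)).toClass = u' := by
      induction u' using Quotient.inductionOn
      exact ArrowE.toClass_eq (.id_comp _ _)
    exact this _)
  assoc {f g h k} u v w := HomE.ext (funext fun p => by
    have (u' : ArrowE.Class α f g) (v' : ArrowE.Class α g h) (w' : ArrowE.Class α h k) :
        (u'.comp v').comp w' = u'.comp (v'.comp w') := by
      induction u', v', w' using Quotient.inductionOn₃
      exact ArrowE.toClass_eq (.symm (.assoc _ _ _))
    exact this _ _ _)

/-- Insertion of arrows. -/
def ins (a : Word) {g g' f f' : TermE G} (v : HomE α g g') (u : HomE α f f') :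
    HomE α (g.ins a f) (g'.ins a f') where
  legit_iff := ⟨fun p => ⟨v.legit_iff.1 p.1, u.legit_iff.1 p.2.1, (v.arr p.1).s_eq ▸ p.2.2⟩,
    fun p => ⟨v.legit_iff.2 p.1, u.legit_iff.2 p.2.1, (v.arr (v.legit_iff.2 p.1)).s_eq ▸ p.2.2⟩⟩
  arr p := (v.arr p.1).ins a (u.arr p.2.1) p
    ⟨v.legit_iff.1 p.1, u.legit_iff.1 p.2.1, (v.arr p.1).s_eq ▸ p.2.2⟩

theorem betaE {h g f : TermE G} {b a c : Word} (e : c = b ++ a)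
    (p : ((h.ins b g).ins c f).Legit α) : BetaE α h b g a f c := by
  subst e
  exact ⟨rfl, p, (TermE.legit_beta_iff h g f b a).1 p⟩

theorem betaE' {h g f : TermE G} {b a c : Word} (e : c = b ++ a)
    (p : (h.ins b (g.ins a f)).Legit α) : BetaE α h b g a f c := by
  subst e
  exact ⟨rfl, (TermE.legit_beta_iff h g f b a).2 p, p⟩

theorem thetaE {h g f : TermE G} {b a : Word} (e : Indep b a)
    (p : ((h.ins b g).ins a f).Legit α) : ThetaE α h b g a f :=
  ⟨e.ne.symm, p, TermE.legit_theta e p⟩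

end HomE

/-- The insertion system of the terms indexed by places. -/
abbrev HomE.insertionSystem {G : Type u} (α : G → ℕ) : InsertionSystem G :=
  letI := HomE.category α
  { toCategory := HomE.category α
    Legit f := f.Legit α
    IsUnit f := f = .unit
    Assoc b a c := c = b ++ a
    legit_iff u := u.legit_iff
    legit_left p := p.1
    legit_right p := p.2.1
    assoc_prefix := by
      rintro b a _ rfl
      exact List.prefix_append b a
    assoc_unique e e' := List.append_cancel_left (e.symm.trans e')
    assoc_assoc := by
      rintro c b _ a _ rfl rfl
      exact ⟨_, rfl, List.append_assoc _ _ _⟩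
    assoc_split := by
      rintro c b _ a rfl hi hlt
      by_cases hc : c <+: a
      · obtain ⟨a', rfl⟩ := hc
        exact .inr ⟨a', rfl, indep_append_left.1 hi, append_lt_append_left_iff.1 hlt⟩
      · have hi' : Indep c a := ⟨hc, fun h => hi.2 (h.trans (List.prefix_append c b))⟩
        exact .inl ⟨hi', (hi'.symm.lt_of_prefix' (List.prefix_append c b)).1 hlt⟩
    unit_ne_ins h := nomatch h
    unit_place := by
      rintro _ f g a b rfl p q
      exact Eq.trans p.2.2 (Eq.symm q.2.2)
    unit_unit := by
      rintro _ _ a rfl rfl -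
      rfl
    unit_assoc_right := by
      rintro h _ f b a _ rfl rfl p
      have : a = [] := p.2.1.2.2
      simp [this]
    unit_assoc_left := by
      rintro _ g f b a _ rfl rfl p
      have : b = [] := p.2.2
      simp [this]
    unit_self_right := by
      rintro f _ c rfl -
      exact ⟨[], by simp, trivial, trivial, rfl⟩
    unit_self_left := by
      rintro f _ b rfl p
      obtain rfl : b = [] := p.2.2
      exact ⟨rfl, trivial, trivial, rfl⟩
    map a _ _ _ _ v u := HomE.ins a v u
    beta {b a c} e h g f :=
      { hom := ⟨by subst e; exact TermE.legit_beta_iff h g f b a,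
          fun p => (ArrowE.beta h b g a f c (HomE.betaE e p)).toClass⟩
        inv := ⟨by subst e; exact (TermE.legit_beta_iff h g f b a).symm,
          fun p => (ArrowE.betaInv h b g a f c (HomE.betaE' e p)).toClass⟩
        hom_inv_id := HomE.ext (funext fun p => ArrowE.toClass_eq (.betaInv_beta h b g a f c _))
        inv_hom_id := HomE.ext (funext fun p => ArrowE.toClass_eq (.beta_betaInv h b g a f c _)) }
    theta {b a} e h g f := ⟨TermE.legit_theta_iff h g f e,
      fun p => (ArrowE.theta h b g a f (HomE.thetaE e p)).toClass⟩
    mu {f i a} hi p :=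
      { hom := ⟨⟨fun _ => p.1, fun _ => p⟩, fun _ => by
          subst hi; exact (ArrowE.mu f a p).toClass⟩
        inv := ⟨⟨fun _ => p, fun _ => p.1⟩, fun _ => by
          subst hi; exact (ArrowE.muInv f a p).toClass⟩
        hom_inv_id := by
          subst hi; exact HomE.ext (funext fun p => ArrowE.toClass_eq (.muInv_mu f a p))
        inv_hom_id := by
          subst hi; exact HomE.ext (funext fun q => ArrowE.toClass_eq (.mu_muInv f a p q)) }
    lam {f i a} hi p :=
      { hom := ⟨⟨fun _ => p.2.1, fun _ => p⟩, fun _ => by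
          subst hi; obtain rfl : a = [] := p.2.2; exact (ArrowE.lam f p.2.1).toClass⟩
        inv := ⟨⟨fun _ => p, fun _ => p.2.1⟩, fun _ => by
          subst hi; obtain rfl : a = [] := p.2.2; exact (ArrowE.lamInv f p.2.1).toClass⟩
        hom_inv_id := by
          subst hi
          obtain rfl : a = [] := p.2.2
          exact HomE.ext (funext fun q => ArrowE.toClass_eq (.lamInv_lam f p.2.1 q))
        inv_hom_id := by
          subst hi
          obtain rfl : a = [] := p.2.2
          exact HomE.ext (funext fun q => ArrowE.toClass_eq (.lam_lamInv f q)) }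
    map_id a g f := HomE.ext (funext fun p => ArrowE.toClass_eq (.ins_id g f a _ _ p))
    map_comp a g₁ g₂ g₃ f₁ f₂ f₃ v₁ v₂ u₁ u₂ := by
      refine HomE.ext (funext fun p => ?_)
      have (v₁' : ArrowE.Class α g₁ g₂) (v₂' : ArrowE.Class α g₂ g₃) (u₁' : ArrowE.Class α f₁ f₂)
          (u₂' : ArrowE.Class α f₂ f₃) (p₁ p₂ p₃) :
          (v₁'.comp v₂').ins a (u₁'.comp u₂') p₁ p₃ =
            (v₁'.ins a u₁' p₁ p₂).comp (v₂'.ins a u₂' p₂ p₃) := by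
        induction v₁', v₂' using Quotient.inductionOn₂
        induction u₁', u₂' using Quotient.inductionOn₂
        exact ArrowE.toClass_eq (.ins_comp a _ _ _ _ _ _ _)
      exact this _ _ _ _ _ _ _
    beta_nat {b a c} e h₁ h₂ g₁ g₂ f₁ f₂ w v u := by
      refine HomE.ext (funext fun p => ?_)
      have (w' : ArrowE.Class α h₁ h₂) (v' : ArrowE.Class α g₁ g₂) (u' : ArrowE.Class α f₁ f₂)
          (p₁ : BetaE α h₁ b g₁ a f₁ c) (p₂ : BetaE α h₂ b g₂ a f₂ c) (q₁ q₂ q₃ q₄) :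
          ((w'.ins b v' q₁ q₂).ins c u' p₁.left p₂.left).comp
              (ArrowE.beta h₂ b g₂ a f₂ c p₂).toClass =
            (ArrowE.beta h₁ b g₁ a f₁ c p₁).toClass.comp
              (w'.ins b (v'.ins a u' q₃ q₄) p₁.right p₂.right) := by
        induction w', v', u' using Quotient.inductionOn₃
        exact ArrowE.toClass_eq (.beta_nat b a c _ _ _ p₁ p₂ q₁ q₂ q₃ q₄)
      exact this _ _ _ (HomE.betaE e p) _ _ _ _ _
    theta_nat {b a} e h₁ h₂ g₁ g₂ f₁ f₂ w v u := by
      refine HomE.ext (funext fun p => ?_)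
      have (w' : ArrowE.Class α h₁ h₂) (v' : ArrowE.Class α g₁ g₂) (u' : ArrowE.Class α f₁ f₂)
          (p₁ : ThetaE α h₁ b g₁ a f₁) (p₂ : ThetaE α h₂ b g₂ a f₂) (q₁ q₂ q₃ q₄) :
          ((w'.ins b v' q₁ q₂).ins a u' p₁.left p₂.left).comp
              (ArrowE.theta h₂ b g₂ a f₂ p₂).toClass =
            (ArrowE.theta h₁ b g₁ a f₁ p₁).toClass.comp
              ((w'.ins a u' q₃ q₄).ins b v' p₁.right p₂.right) := by
        induction w', v', u' using Quotient.inductionOn₃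
        exact ArrowE.toClass_eq (.theta_nat b a _ _ _ p₁ p₂ q₁ q₂ q₃ q₄)
      exact this _ _ _ (HomE.thetaE e p) _ _ _ _ _
    theta_theta e h g f := HomE.ext (funext fun p => ArrowE.toClass_eq (.theta_theta h _ g _ f _ _))
    mu_nat {f₁ f₂ i a} hi p₁ p₂ u := by
      subst hi
      refine HomE.ext (funext fun p => ?_)
      have (u' : ArrowE.Class α f₁ f₂) :
          (u'.ins a (ArrowE.id .unit trivial).toClass p₁ p₂).comp (ArrowE.mu f₂ a p₂).toClass =
            (ArrowE.mu f₁ a p₁).toClass.comp u' := by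
        induction u' using Quotient.inductionOn
        exact ArrowE.toClass_eq (.mu_nat _ a p₁ p₂ trivial)
      exact this _
    lam_nat {f₁ f₂ i a} hi p₁ p₂ u := by
      subst hi
      obtain rfl : a = [] := p₁.2.2
      refine HomE.ext (funext fun p => ?_)
      have (u' : ArrowE.Class α f₁ f₂) :
          ((ArrowE.id .unit trivial).toClass.ins [] u' p₁ p₂).comp (ArrowE.lam f₂ p₂.2.1).toClass =
            (ArrowE.lam f₁ p₁.2.1).toClass.comp u' := by
        induction u' using Quotient.inductionOn
        exact ArrowE.toClass_eq (.lam_nat _ _ _ trivial p₁ p₂)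
      exact this _
    beta_pent e₁ e₂ e₃ e₄ j h g f := HomE.ext (funext fun p => ArrowE.toClass_eq
      (.trans (.assoc _ _ _) (.beta_pent j h g f _ _ _ _ _ _ p.1.1.1 p.2.1 _ _ _ _ _ _ _ _ _)))
    theta_YB e₁ e₂ e₃ j h g f := HomE.ext (funext fun p => ArrowE.toClass_eq
      (.trans (.assoc _ _ _) (.trans (.theta_YB j h g f _ _ _ p.1.1.2.1 p.1.2.1 p.2.1
        _ _ _ _ _ _ _ _ _ _ _ _) (.symm (.assoc _ _ _)))))
    beta_theta_one e₁ e₂ e₃ e₄ j h g f := HomE.ext (funext fun p => ArrowE.toClass_eq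
      (.trans (.assoc _ _ _) (.trans (.beta_theta_one j h g f _ _ _ _ _ p.1.1.1 p.1.2.1 p.2.1
        _ _ _ _ _ _ _ _ _ _ _ _) (.symm (.assoc _ _ _)))))
    beta_theta_two e₁ e₂ e₃ j h g f := HomE.ext (funext fun p => ArrowE.toClass_eq
      (.trans (.beta_theta_two j h g f _ _ _ _ p.1.2.1 p.2.1 _ _ _ _ _ _ _ _ _)
        (.symm (.assoc _ _ _))))
    beta_mu_lam {h i f b a} hi e q₁ q₂ := by
      subst hi
      obtain rfl : a = [] := q₂.2.2
      refine HomE.ext (funext fun p => ?_)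
      have p' : (h.ins b f).Legit α := ⟨q₁.1, q₂.2.1, q₁.2.2⟩
      have P := HomE.betaE e p
      -- The equation of the category expresses `β` through `λ⁻¹`; composing with `λ` cancels it.
      refine ArrowE.toClass_eq (.trans (.comp_congr (.beta_mu_lam h f b q₁.1 q₂.2.1 P q₁ p' _ _)
        (.refl _)) (.trans (.symm (.assoc _ _ _)) (.trans (.comp_congr (.refl _)
        (.trans (.symm (.ins_comp b _ _ _ _ _ _ _)) (.trans (.ins_congr b _ _
          (.lam_lamInv f _) (.id_comp _ _)) (.ins_id h f b _ _ _)))) (.id_comp _ _))))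
    theta_mu {h i f b a} hi e q₁ q₂ := by
      subst hi
      refine HomE.ext (funext fun p => ?_)
      exact ArrowE.toClass_eq (.trans (.comp_congr (.theta_mu h f b a p.2.1 _ q₁ _ q₂.1)
        (.refl _)) (.trans (.symm (.assoc _ _ _)) (.trans (.comp_congr (.refl _)
          (.mu_muInv _ b q₂ q₂.1)) (.id_comp _ _)))) }

open InsertionSystem in
-- Each generator is an identity, a step, the inverse of a step or some `θ`, and reducible arrows
-- are closed under composition and insertion.
theorem ArrowE.reducible {G : Type u} {α : G → ℕ} {f g : TermE G} (u : ArrowE α f g) :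
    letI := HomE.insertionSystem α
    Reducible (L := G) (x := f) (y := g) (HomE.mk' u) := by
  let := HomE.insertionSystem α
  induction u with
  | id f p => exact (Path.nil (L := G) f).reducible
  | beta h b g a f c p => exact (Step.beta (L := G) p.word h g f).reducible
  | betaInv h b g a f c p => exact (Step.beta (L := G) p.word h g f).reducible_inv
  | theta h b g a f p => exact reducible_theta (L := G) p.indep h g f
  | mu f a p => exact (Step.mu (L := G) (i := .unit) rfl p).reducible
  | muInv f a p => exact (Step.mu (L := G) (i := .unit) rfl p).reducible_inv
  | lam f p =>
    exact (Step.lam (L := G) (i := .unit) (a := []) rfl ⟨trivial, p, rfl⟩).reducible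
  | lamInv f p =>
    exact (Step.lam (L := G) (i := .unit) (a := []) rfl ⟨trivial, p, rfl⟩).reducible_inv
  | comp v u ihv ihu => exact Reducible.comp ihu ihv
  | ins a v u p p' ihv ihu => exact Reducible.map a ihv ihu

/-- All diagrams of arrow terms of `WOe` commute. -/
theorem ArrowE.equ {G : Type u} {α : G → ℕ} {f g : TermE G} (u v : ArrowE α f g) : Equ u v := by
  let := HomE.insertionSystem α
  have e := InsertionSystem.Reducible.eq (L := G) u.legit.1 u.reducible v.reducible
  exact Quotient.exact (congrFun (congrArg HomE.arr e) u.legit.1)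

/-! ### Terms with diversified generators -/

namespace TermU

variable {G : Type u} {α : G → ℕ}

theorem mem_s_ins {g f : TermU G} {w : Word} :
    w ∈ (g.ins f).s α ↔ (w ∈ g.s α ∧ w ≠ f.t) ∨ w ∈ f.s α :=
  Iff.rfl

/-- Since places are absolute here, this replaces the shift by `a` in the arguments about prefixes.
-/
theorem Legit.t_prefix {f : TermU G} (hf : f.Legit α) {w : Word} (hw : w ∈ f.s α) : f.t <+: w := by
  induction f generalizing w with
  | gen a x =>
    obtain ⟨b, -, rfl⟩ := hw
    exact List.prefix_append a b
  | unit a => exact hw ▸ List.prefix_rfl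
  | ins g f ihg ihf =>
    rcases hw with ⟨hw, -⟩ | hw
    · exact ihg hf.1 hw
    · exact (ihg hf.1 hf.2.2).trans (ihf hf.2.1 hw)

theorem Legit.prefix_free {f : TermU G} (hf : f.Legit α) {w w' : Word} (hw : w ∈ f.s α)
    (hw' : w' ∈ f.s α) (h : w <+: w') : w = w' := by
  induction f generalizing w w' with
  | gen a x =>
    obtain ⟨b, hb, rfl⟩ := hw
    obtain ⟨b', hb', rfl⟩ := hw'
    rw [genArity_prefix_free hb hb' (by simpa using h)]
  | unit => exact Eq.trans hw hw'.symm
  | ins g f ihg ihf =>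
    obtain ⟨hg, hf, ha⟩ := hf
    rcases hw with ⟨hw, hwa⟩ | hw <;> rcases hw' with ⟨hw', hwa'⟩ | hw'
    · exact ihg hg hw hw' h
    · rcases List.prefix_or_prefix_of_prefix h (hf.t_prefix hw') with h' | h'
      · exact absurd (ihg hg hw ha h') hwa
      · exact absurd (ihg hg ha hw h').symm hwa
    · exact absurd (ihg hg ha hw' ((hf.t_prefix hw).trans h)).symm hwa'
    · exact ihf hf hw hw' h

theorem Legit.indep {f : TermU G} (hf : f.Legit α) {a b : Word} (ha : a ∈ f.s α) (hb : b ∈ f.s α)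
    (hne : a ≠ b) : Indep a b :=
  ⟨fun h => hne (hf.prefix_free ha hb h), fun h => hne (hf.prefix_free hb ha h).symm⟩

/-- The prefix condition excludes that `f` is inserted at a place left over from `h`, where `θ`
would apply instead. -/
theorem legit_beta_iff (h g f : TermU G) (e : g.t <+: f.t) :
    ((h.ins g).ins f).Legit α ↔ (h.ins (g.ins f)).Legit α := by
  constructor
  · rintro ⟨⟨hh, hg, hb⟩, hf, ⟨hc, hne⟩ | ha⟩
    · exact absurd (hh.prefix_free hb hc e).symm hne
    · exact ⟨hh, ⟨hg, hf, ha⟩, hb⟩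
  · rintro ⟨hh, ⟨hg, hf, ha⟩, hb⟩
    exact ⟨⟨hh, hg, hb⟩, hf, .inr ha⟩

theorem legit_theta {h g f : TermU G} (e : Indep g.t f.t) (p : ((h.ins g).ins f).Legit α) :
    ((h.ins f).ins g).Legit α := by
  obtain ⟨⟨hh, hg, hb⟩, hf, ⟨ha, hne⟩ | ha⟩ := p
  · exact ⟨⟨hh, hf, ha⟩, hg, .inl ⟨hb, e.ne⟩⟩
  · exact absurd (hg.t_prefix ha) e.1

theorem s_beta {h g f : TermU G} (p : (h.ins (g.ins f)).Legit α) :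
    ((h.ins g).ins f).s α = (h.ins (g.ins f)).s α := by
  obtain ⟨hh, ⟨hg, hf, ha⟩, hb⟩ := p
  ext w
  simp only [mem_s_ins]
  constructor
  · rintro (⟨⟨hw, hwb⟩ | hw, hwa⟩ | hw)
    · exact .inl ⟨hw, hwb⟩
    · exact .inr (.inl ⟨hw, hwa⟩)
    · exact .inr (.inr hw)
  · rintro (⟨hw, hwb⟩ | ⟨hw, hwa⟩ | hw)
    · refine .inl ⟨.inl ⟨hw, hwb⟩, ?_⟩
      rintro rfl
      exact hwb (hh.prefix_free hb hw (hg.t_prefix ha)).symm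
    · exact .inl ⟨.inr hw, hwa⟩
    · exact .inr hw

theorem s_theta_subset {h g f : TermU G} (hf : f.Legit α) (e : Indep g.t f.t) :
    ((h.ins g).ins f).s α ⊆ ((h.ins f).ins g).s α := by
  rintro w (⟨⟨hw, hwb⟩ | hw, hwa⟩ | hw)
  · exact .inl ⟨.inl ⟨hw, hwa⟩, hwb⟩
  · exact .inr hw
  · refine .inl ⟨.inr hw, ?_⟩
    rintro rfl
    exact e.2 (hf.t_prefix hw)

theorem s_mu {f : TermU G} {a : Word} (p : (f.ins (.unit a)).Legit α) :
    (f.ins (.unit a)).s α = f.s α := by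
  ext w
  simp only [mem_s_ins]
  constructor
  · rintro (⟨hw, -⟩ | rfl)
    exacts [hw, p.2.2]
  · intro hw
    by_cases e : w = a
    · exact .inr e
    · exact .inl ⟨hw, e⟩

theorem s_lam {f : TermU G} {a : Word} (p : ((TermU.unit a).ins f).Legit α) :
    ((TermU.unit a).ins f).s α = f.s α := by
  have e : f.t = a := p.2.2
  ext w
  simp only [mem_s_ins]
  constructor
  · rintro (⟨hw, hne⟩ | hw)
    · exact absurd (Eq.trans hw e.symm) hne
    · exact hw
  · exact .inr

end TermU

theorem BetaU.t_prefix {G : Type u} {α : G → ℕ} {h g f : TermU G} (p : BetaU α h g f) :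
    g.t <+: f.t :=
  p.right.2.1.1.t_prefix p.right.2.1.2.2

theorem ThetaU.indep {G : Type u} {α : G → ℕ} {h g f : TermU G} (p : ThetaU α h g f) :
    Indep g.t f.t :=
  p.left.1.1.indep p.left.1.2.2 p.right.1.2.2 p.ne.symm

namespace ArrowU

variable {G : Type u} {α : G → ℕ}

theorem legit {f g : TermU G} (u : ArrowU α f g) : f.Legit α ∧ g.Legit α := by
  induction u with
  | id f p => exact ⟨p, p⟩
  | beta h g f p => exact ⟨p.left, p.right⟩
  | betaInv h g f p => exact ⟨p.right, p.left⟩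
  | theta h g f p => exact ⟨p.left, p.right⟩
  | mu f a p => exact ⟨p, p.1⟩
  | muInv f a p => exact ⟨p.1, p⟩
  | lam a f p => exact ⟨p, p.2.1⟩
  | lamInv a f p => exact ⟨p.2.1, p⟩
  | comp v u ihv ihu => exact ⟨ihu.1, ihv.2⟩
  | ins v u p p' => exact ⟨p, p'⟩

theorem t_eq {f g : TermU G} (u : ArrowU α f g) : f.t = g.t := by
  induction u with
  | lam a f p => exact Eq.symm p.2.2
  | lamInv a f p => exact p.2.2
  | comp v u ihv ihu => exact ihu.trans ihv
  | ins v u p p' ihv => exact ihv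
  | _ => rfl

theorem s_eq {f g : TermU G} (u : ArrowU α f g) : f.s α = g.s α := by
  induction u with
  | id f p => rfl
  | beta h g f p => exact TermU.s_beta p.right
  | betaInv h g f p => exact (TermU.s_beta p.right).symm
  | theta h g f p =>
    exact (TermU.s_theta_subset p.left.2.1 p.indep).antisymm
      (TermU.s_theta_subset p.right.2.1 p.indep.symm)
  | mu f a p => exact TermU.s_mu p
  | muInv f a p => exact (TermU.s_mu p).symm
  | lam a f p => exact TermU.s_lam p
  | lamInv a f p => exact (TermU.s_lam p).symm
  | comp v u ihv ihu => exact ihu.trans ihv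
  | ins v u p p' ihv ihu => simp only [TermU.s, ihv, ihu, u.t_eq]

theorem Equ.beta_comp_lam {h f : TermU G} {a : Word} (ph pf) (p : BetaU α h (.unit a) f)
    (pl : ((TermU.unit a).ins f).Legit α) (pm : (h.ins (.unit a)).Legit α)
    (q : (h.ins f).Legit α) :
    Equ (comp (ins (id h ph) (lam a f pl) p.right q) (beta h (.unit a) f p))
      (ins (mu h a pm) (id f pf) p.left q) :=
  .trans (.comp_congr (.beta_mu_lam h f a ph pf p pl pm q) (.refl _))
    (.trans (.symm (.assoc _ _ _)) (.trans (.comp_congr (.refl _)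
      (.trans (.symm (.ins_comp _ _ _ _ q p.right q)) (.trans
        (.ins_congr q q (.lam_lamInv a f pl pf) (.id_comp _ ph)) (.ins_id h f ph pf q))))
      (.id_comp _ q)))

theorem Equ.theta_comp_mu {h f : TermU G} {b : Word} (pf) (p : ThetaU α h (.unit b) f)
    (pm : (h.ins (.unit b)).Legit α) (q : (h.ins f).Legit α) :
    Equ (comp (mu (h.ins f) b p.right) (theta h (.unit b) f p))
      (ins (mu h b pm) (id f pf) p.left q) :=
  .trans (.comp_congr (.theta_mu h f b pf p pm q) (.refl _))
    (.trans (.symm (.assoc _ _ _))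
      (.trans (.comp_congr (.refl _) (.mu_muInv _ b p.right q)) (.id_comp _ q)))

/-- Arrow terms up to the equations. -/
abbrev Class (α : G → ℕ) (f g : TermU G) : Type u := Quotient (ArrowU.setoid α f g)

/-- The arrow of an arrow term. -/
abbrev toClass {f g : TermU G} (u : ArrowU α f g) : Class α f g := Quotient.mk _ u

theorem toClass_eq {f g : TermU G} {u v : ArrowU α f g} (h : Equ u v) : u.toClass = v.toClass :=
  Quotient.sound h

namespace Class

/-- Composition of arrows, in diagrammatic order. -/
def comp {f g h : TermU G} (u : Class α f g) (v : Class α g h) : Class α f h :=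
  Quotient.map₂ (fun u v => ArrowU.comp v u) (fun _ _ hu _ _ hv => Equ.comp_congr hu hv) u v

/-- Insertion of arrows. -/
def ins {g g' f f' : TermU G} (v : Class α g g') (u : Class α f f') (p : (g.ins f).Legit α)
    (p' : (g'.ins f').Legit α) : Class α (g.ins f) (g'.ins f') :=
  Quotient.map₂ (fun v u => ArrowU.ins v u p p')
    (fun _ _ hv _ _ hu => Equ.ins_congr p p' hu hv) v u

theorem s_eq {f g : TermU G} (u : Class α f g) : f.s α = g.s α :=
  Quotient.inductionOn u ArrowU.s_eq

theorem t_eq {f g : TermU G} (u : Class α f g) : f.t = g.t :=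
  Quotient.inductionOn u ArrowU.t_eq

end Class

end ArrowU

/-! ### Labelled expressions -/

/-- Expressions in which every insertion is labelled by a word, and every leaf by a word and
possibly a generator. -/
abbrev Labelled (G : Type u) : Type u := TermE (Word × Option G)

namespace Labelled

variable {G : Type u} {α : G → ℕ}

/-- The underlying expression with diversified generators. -/
def dec : Labelled G → TermU G
  | .gen (a, some x) => .gen a x
  | .gen (a, none) => .unit a
  -- A junk value: `a · I` is encoded as a leaf without a generator, and this leaf is never
  -- legitimate.
  | .unit => .unit []
  | .ins g _ f => .ins (dec g) (dec f)

/-- An expression is labelled by the target words of what is inserted. -/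
def enc : TermU G → Labelled G
  | .gen a x => .gen (a, some x)
  | .unit a => .gen (a, none)
  | .ins g f => .ins (enc g) f.t (enc f)

theorem dec_enc (f : TermU G) : dec (enc f) = f := by
  induction f with
  | gen | unit => rfl
  | ins g f ihg ihf => simp only [enc, dec, ihg, ihf]

/-- Legitimacy of the underlying expression and correctness of the labels. -/
def Legit (α : G → ℕ) : Labelled G → Prop
  | .gen _ => True
  | .unit => False
  | .ins g a f => Legit α g ∧ Legit α f ∧ a = (dec f).t ∧ a ∈ (dec g).s α

theorem Legit.dec {x : Labelled G} (p : Legit α x) : x.dec.Legit α := by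
  induction x with
  | gen l => rcases l with ⟨a, _ | x⟩ <;> trivial
  | unit => trivial
  | ins g a f ihg ihf => exact ⟨ihg p.1, ihf p.2.1, p.2.2.1 ▸ p.2.2.2⟩

theorem legit_enc {f : TermU G} (p : f.Legit α) : Legit α (enc f) := by
  induction f with
  | gen | unit => trivial
  | ins g f ihg ihf => exact ⟨ihg p.1, ihf p.2.1, by rw [dec_enc], by rw [dec_enc]; exact p.2.2⟩

/-- The units are the leaves without a generator. -/
def IsUnit (x : Labelled G) : Prop := ∃ a, x = .gen (a, none)

theorem IsUnit.eq_of_right {f i : Labelled G} {a : Word} (hi : IsUnit i)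
    (p : Legit α (f.ins a i)) : i = .gen (a, none) := by
  obtain ⟨b, rfl⟩ := hi
  obtain rfl : a = b := p.2.2.1
  rfl

theorem IsUnit.eq_of_left {f i : Labelled G} {a : Word} (hi : IsUnit i)
    (p : Legit α (i.ins a f)) : i = .gen (a, none) := by
  obtain ⟨b, rfl⟩ := hi
  obtain rfl : a = b := p.2.2.2
  rfl

theorem legit_beta_iff (h g f : Labelled G) {b c : Word} (e : b <+: c) :
    Legit α ((h.ins b g).ins c f) ↔ Legit α (h.ins b (g.ins c f)) := by
  constructor
  · intro p
    obtain ⟨⟨hh, hg, rfl, hb⟩, hf, rfl, -⟩ := id p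
    have q := (TermU.legit_beta_iff _ _ _ e).1 p.dec
    exact ⟨hh, ⟨hg, hf, rfl, q.2.1.2.2⟩, rfl, hb⟩
  · intro p
    obtain ⟨hh, ⟨hg, hf, rfl, ha⟩, rfl, hb⟩ := id p
    exact ⟨⟨hh, hg, rfl, hb⟩, hf, rfl, .inr ha⟩

theorem legit_theta {h g f : Labelled G} {b a : Word} (e : Indep b a)
    (p : Legit α ((h.ins b g).ins a f)) : Legit α ((h.ins a f).ins b g) := by
  obtain ⟨⟨hh, hg, rfl, hb⟩, hf, rfl, -⟩ := id p
  have q := TermU.legit_theta e p.dec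
  exact ⟨⟨hh, hf, rfl, q.1.2.2⟩, hg, rfl, q.2.2⟩

theorem legit_theta_iff (h g f : Labelled G) {b a : Word} (e : Indep b a) :
    Legit α ((h.ins b g).ins a f) ↔ Legit α ((h.ins a f).ins b g) :=
  ⟨legit_theta e, legit_theta e.symm⟩

theorem betaU {h g f : Labelled G} {b c : Word} (e : b <+: c)
    (p : Legit α ((h.ins b g).ins c f)) : BetaU α h.dec g.dec f.dec :=
  ⟨p.dec, ((legit_beta_iff h g f e).1 p).dec⟩

theorem thetaU {h g f : Labelled G} {b a : Word} (e : Indep b a)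
    (p : Legit α ((h.ins b g).ins a f)) : ThetaU α h.dec g.dec f.dec :=
  ⟨p.1.2.2.1 ▸ p.2.2.1 ▸ e.ne.symm, p.dec, (legit_theta e p).dec⟩

end Labelled

open Labelled

/-! ### The category of labelled expressions as an insertion system -/

/-- The arrows between expressions: a source and a target that are both legitimate or both not,
and an arrow in the first case. -/
@[ext]
structure HomU {G : Type u} (α : G → ℕ) (f g : Labelled G) : Type u where
  legit_iff : Legit α f ↔ Legit α g
  arr : Legit α f → ArrowU.Class α f.dec g.dec

namespace HomU

variable {G : Type u} {α : G → ℕ}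

/-- Identity arrows. -/
def id (f : Labelled G) : HomU α f f := ⟨Iff.rfl, fun p => (ArrowU.id f.dec p.dec).toClass⟩

/-- Composition of arrows, in diagrammatic order. -/
def comp {f g h : Labelled G} (u : HomU α f g) (v : HomU α g h) : HomU α f h :=
  ⟨u.legit_iff.trans v.legit_iff, fun p => (u.arr p).comp (v.arr (u.legit_iff.1 p))⟩

/-- Expressions as a category. -/
abbrev category (α : G → ℕ) : Category.{u} (Labelled G) where
  Hom f g := HomU α f g
  id f := id f
  comp u v := comp u v
  id_comp {f g} u := HomU.ext (funext fun p => by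
    have (u' : ArrowU.Class α f.dec g.dec) : (ArrowU.id _ p.dec).toClass.comp u' = u' := by
      induction u' using Quotient.inductionOn
      exact ArrowU.toClass_eq (.comp_id _ p.dec)
    exact this _)
  comp_id {f g} u := HomU.ext (funext fun p => by
    have (u' : ArrowU.Class α f.dec g.dec) :
        u'.comp (ArrowU.id _ (u.legit_iff.1 p).dec).toClass = u' := by
      induction u' using Quotient.inductionOn
      exact ArrowU.toClass_eq (.id_comp _ _)
    exact this _)
  assoc {f g h k} u v w := HomU.ext (funext fun p => by
    have (u' : ArrowU.Class α f.dec g.dec) (v' : ArrowU.Class α g.dec h.dec)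
        (w' : ArrowU.Class α h.dec k.dec) :
        (u'.comp v').comp w' = u'.comp (v'.comp w') := by
      induction u', v', w' using Quotient.inductionOn₃
      exact ArrowU.toClass_eq (.symm (.assoc _ _ _))
    exact this _ _ _)

theorem legit_ins {a : Word} {g g' f f' : Labelled G} (v : HomU α g g') (u : HomU α f f')
    (p : Legit α (g.ins a f)) : Legit α (g'.ins a f') :=
  ⟨v.legit_iff.1 p.1, u.legit_iff.1 p.2.1, (u.arr p.2.1).t_eq ▸ p.2.2.1,
    (v.arr p.1).s_eq ▸ p.2.2.2⟩

/-- Insertion of arrows. -/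
def ins (a : Word) {g g' f f' : Labelled G} (v : HomU α g g') (u : HomU α f f') :
    HomU α (g.ins a f) (g'.ins a f') where
  legit_iff := ⟨legit_ins v u, fun p => ⟨v.legit_iff.2 p.1, u.legit_iff.2 p.2.1,
    (u.arr (u.legit_iff.2 p.2.1)).t_eq ▸ p.2.2.1, (v.arr (v.legit_iff.2 p.1)).s_eq ▸ p.2.2.2⟩⟩
  arr p := (v.arr p.1).ins (u.arr p.2.1) p.dec (legit_ins v u p).dec

end HomU

/-- The insertion system of the labelled expressions. -/
abbrev HomU.insertionSystem {G : Type u} (α : G → ℕ) : InsertionSystem (Word × Option G) :=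
  letI := HomU.category α
  { toCategory := HomU.category α
    Legit x := Labelled.Legit α x
    IsUnit x := Labelled.IsUnit x
    -- Places are absolute, so re-association keeps the label; the prefix condition says that the
    -- insertion at `c` lies within what was inserted at `b`.
    Assoc b a c := a = c ∧ b <+: c
    legit_iff u := u.legit_iff
    legit_left p := p.1
    legit_right p := p.2.1
    assoc_prefix p := p.2
    assoc_unique e e' := e.1.trans e'.1.symm
    assoc_assoc := by
      rintro c b _ a _ ⟨rfl, h⟩ ⟨rfl, h'⟩
      exact ⟨_, ⟨rfl, h'⟩, rfl, h.trans h'⟩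
    assoc_split := by
      rintro c b _ a ⟨rfl, h⟩ hi hlt
      by_cases hc : c <+: a
      · exact .inr ⟨a, ⟨rfl, hc⟩, hi, hlt⟩
      · have hi' : Indep c a := ⟨hc, fun h' => hi.2 (h'.trans h)⟩
        exact .inl ⟨hi', (hi'.symm.lt_of_prefix' h).1 hlt⟩
    unit_ne_ins := by
      rintro g f a ⟨_, h⟩
      cases h
    unit_place := by
      rintro i f g a b hi p q
      obtain rfl := hi.eq_of_left p
      simpa using hi.eq_of_left q
    unit_unit hi hj p := (hi.eq_of_left p).trans (hj.eq_of_right p).symm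
    unit_assoc_right := by
      rintro h i f b a c hi ⟨rfl, -⟩ p
      obtain rfl := hi.eq_of_left p.2.1
      exact p.2.2.1.symm
    unit_assoc_left _ e _ := e.1
    unit_self_right := by
      rintro f i c hi p
      obtain rfl := hi.eq_of_right p
      exact ⟨c, ⟨rfl, List.prefix_rfl⟩, trivial, trivial, rfl, rfl⟩
    unit_self_left := by
      rintro f i b hi p
      obtain rfl := hi.eq_of_left p
      exact ⟨⟨rfl, List.prefix_rfl⟩, trivial, trivial, rfl, rfl⟩
    map a _ _ _ _ v u := HomU.ins a v u
    beta {b a c} e h g f :=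
      { hom := ⟨by obtain ⟨rfl, e⟩ := e; exact legit_beta_iff h g f e,
          fun p => (ArrowU.beta (dec h) (dec g) (dec f) (betaU e.2 p)).toClass⟩
        inv := ⟨by obtain ⟨rfl, e⟩ := e; exact (legit_beta_iff h g f e).symm,
          fun p => (ArrowU.betaInv (dec h) (dec g) (dec f) (betaU e.2
            (by obtain ⟨rfl, e⟩ := e; exact (legit_beta_iff h g f e).2 p))).toClass⟩
        hom_inv_id := HomU.ext (funext fun p => ArrowU.toClass_eq (.betaInv_beta _ _ _ _))
        inv_hom_id := HomU.ext (funext fun p => ArrowU.toClass_eq (.beta_betaInv _ _ _ _)) }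
    theta {b a} e h g f := ⟨legit_theta_iff h g f e,
      fun p => (ArrowU.theta (dec h) (dec g) (dec f) (thetaU e p)).toClass⟩
    mu {f i a} hi p :=
      { hom := ⟨⟨fun _ => p.1, fun _ => p⟩, fun _ => by
          obtain rfl := hi.eq_of_right p; exact (ArrowU.mu (dec f) a p.dec).toClass⟩
        inv := ⟨⟨fun _ => p, fun _ => p.1⟩, fun _ => by
          obtain rfl := hi.eq_of_right p; exact (ArrowU.muInv (dec f) a p.dec).toClass⟩
        hom_inv_id := by
          obtain rfl := hi.eq_of_right p
          exact HomU.ext (funext fun p => ArrowU.toClass_eq (.muInv_mu (dec f) a p.dec))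
        inv_hom_id := by
          obtain rfl := hi.eq_of_right p
          exact HomU.ext (funext fun q => ArrowU.toClass_eq (.mu_muInv (dec f) a p.dec q.dec)) }
    lam {f i a} hi p :=
      { hom := ⟨⟨fun _ => p.2.1, fun _ => p⟩, fun _ => by
          obtain rfl := hi.eq_of_left p; exact (ArrowU.lam a (dec f) p.dec).toClass⟩
        inv := ⟨⟨fun _ => p, fun _ => p.2.1⟩, fun _ => by
          obtain rfl := hi.eq_of_left p; exact (ArrowU.lamInv a (dec f) p.dec).toClass⟩
        hom_inv_id := by
          obtain rfl := hi.eq_of_left p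
          exact HomU.ext (funext fun q => ArrowU.toClass_eq (.lamInv_lam a (dec f) p.dec))
        inv_hom_id := by
          obtain rfl := hi.eq_of_left p
          exact HomU.ext (funext fun q => ArrowU.toClass_eq (.lam_lamInv a (dec f) p.dec q.dec)) }
    map_id a g f := HomU.ext (funext fun p => ArrowU.toClass_eq (.ins_id _ _ _ _ p.dec))
    map_comp a g₁ g₂ g₃ f₁ f₂ f₃ v₁ v₂ u₁ u₂ := by
      refine HomU.ext (funext fun p => ?_)
      have (v₁' : ArrowU.Class α (dec g₁) (dec g₂)) (v₂' : ArrowU.Class α (dec g₂) (dec g₃))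
          (u₁' : ArrowU.Class α (dec f₁) (dec f₂)) (u₂' : ArrowU.Class α (dec f₂) (dec f₃))
          (p₁ p₂ p₃) :
          (v₁'.comp v₂').ins (u₁'.comp u₂') p₁ p₃ =
            (v₁'.ins u₁' p₁ p₂).comp (v₂'.ins u₂' p₂ p₃) := by
        induction v₁', v₂' using Quotient.inductionOn₂
        induction u₁', u₂' using Quotient.inductionOn₂
        exact ArrowU.toClass_eq (.ins_comp _ _ _ _ _ _ _)
      exact this _ _ _ _ _ _ _
    beta_nat {b a c} e h₁ h₂ g₁ g₂ f₁ f₂ w v u := by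
      refine HomU.ext (funext fun p => ?_)
      have (w' : ArrowU.Class α (dec h₁) (dec h₂)) (v' : ArrowU.Class α (dec g₁) (dec g₂))
          (u' : ArrowU.Class α (dec f₁) (dec f₂)) (p₁ : BetaU α (dec h₁) (dec g₁) (dec f₁))
          (p₂ : BetaU α (dec h₂) (dec g₂) (dec f₂)) (q₁ q₂ q₃ q₄) :
          ((w'.ins v' q₁ q₂).ins u' p₁.left p₂.left).comp (ArrowU.beta _ _ _ p₂).toClass =
            (ArrowU.beta _ _ _ p₁).toClass.comp
              (w'.ins (v'.ins u' q₃ q₄) p₁.right p₂.right) := by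
        induction w', v', u' using Quotient.inductionOn₃
        exact ArrowU.toClass_eq (.beta_nat _ _ _ p₁ p₂ q₁ q₂ q₃ q₄)
      exact this _ _ _ (betaU e.2 p) _ _ _ _ _
    theta_nat {b a} e h₁ h₂ g₁ g₂ f₁ f₂ w v u := by
      refine HomU.ext (funext fun p => ?_)
      have (w' : ArrowU.Class α (dec h₁) (dec h₂)) (v' : ArrowU.Class α (dec g₁) (dec g₂))
          (u' : ArrowU.Class α (dec f₁) (dec f₂)) (p₁ : ThetaU α (dec h₁) (dec g₁) (dec f₁))
          (p₂ : ThetaU α (dec h₂) (dec g₂) (dec f₂)) (q₁ q₂ q₃ q₄) :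
          ((w'.ins v' q₁ q₂).ins u' p₁.left p₂.left).comp (ArrowU.theta _ _ _ p₂).toClass =
            (ArrowU.theta _ _ _ p₁).toClass.comp
              ((w'.ins u' q₃ q₄).ins v' p₁.right p₂.right) := by
        induction w', v', u' using Quotient.inductionOn₃
        exact ArrowU.toClass_eq (.theta_nat _ _ _ p₁ p₂ q₁ q₂ q₃ q₄)
      exact this _ _ _ (thetaU e p) _ _ _ _ _
    theta_theta e h g f := HomU.ext (funext fun p => ArrowU.toClass_eq (.theta_theta _ _ _ _ _))
    mu_nat {f₁ f₂ i a} hi p₁ p₂ u := by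
      obtain rfl := hi.eq_of_right p₁
      refine HomU.ext (funext fun p => ?_)
      have (u' : ArrowU.Class α (dec f₁) (dec f₂)) :
          (u'.ins (ArrowU.id (.unit a) trivial).toClass p₁.dec p₂.dec).comp
              (ArrowU.mu (dec f₂) a p₂.dec).toClass =
            (ArrowU.mu (dec f₁) a p₁.dec).toClass.comp u' := by
        induction u' using Quotient.inductionOn
        exact ArrowU.toClass_eq (.mu_nat _ a p₁.dec p₂.dec trivial)
      exact this _
    lam_nat {f₁ f₂ i a} hi p₁ p₂ u := by
      obtain rfl := hi.eq_of_left p₁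
      refine HomU.ext (funext fun p => ?_)
      have (u' : ArrowU.Class α (dec f₁) (dec f₂)) :
          ((ArrowU.id (.unit a) trivial).toClass.ins u' p₁.dec p₂.dec).comp
              (ArrowU.lam a (dec f₂) p₂.dec).toClass =
            (ArrowU.lam a (dec f₁) p₁.dec).toClass.comp u' := by
        induction u' using Quotient.inductionOn
        exact ArrowU.toClass_eq (.lam_nat _ a p₁.dec p₂.dec trivial)
      exact this _
    beta_pent e₁ e₂ e₃ e₄ j h g f := HomU.ext (funext fun p => ArrowU.toClass_eq
      (.trans (.assoc _ _ _) (.beta_pent _ _ _ _ p.1.1.1.dec p.2.1.dec _ _ _ _ _ _ _ _ _)))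
    theta_YB e₁ e₂ e₃ j h g f := HomU.ext (funext fun p => ArrowU.toClass_eq
      (.trans (.assoc _ _ _) (.trans (.theta_YB _ _ _ _ p.1.1.2.1.dec p.1.2.1.dec p.2.1.dec
        _ _ _ _ _ _ _ _ _ _ _ _) (.symm (.assoc _ _ _)))))
    beta_theta_one e₁ e₂ e₃ e₄ j h g f := HomU.ext (funext fun p => ArrowU.toClass_eq
      (.trans (.assoc _ _ _) (.trans (.beta_theta_one _ _ _ _ p.1.1.1.dec p.1.2.1.dec p.2.1.dec
        _ _ _ _ _ _ _ _ _ _ _ _) (.symm (.assoc _ _ _)))))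
    beta_theta_two e₁ e₂ e₃ j h g f := HomU.ext (funext fun p => ArrowU.toClass_eq
      (.trans (.beta_theta_two _ _ _ _ p.1.2.1.dec p.2.1.dec _ _ _ _ _ _ _ _ _)
        (.symm (.assoc _ _ _))))
    beta_mu_lam {h i f b a} hi e q₁ q₂ := by
      obtain ⟨rfl, e'⟩ := e
      obtain rfl := hi.eq_of_right q₁
      refine HomU.ext (funext fun p => ?_)
      have p' : ((dec h).ins (dec f)).Legit α := ⟨q₁.1.dec, q₂.2.1.dec, q₂.2.2.1 ▸ q₁.2.2.2⟩
      exact ArrowU.toClass_eq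
        (.beta_comp_lam q₁.1.dec q₂.2.1.dec (betaU e' p) q₂.dec q₁.dec p')
    theta_mu {h i f b a} hi e q₁ q₂ := by
      obtain rfl := hi.eq_of_right q₁
      refine HomU.ext (funext fun p => ?_)
      exact ArrowU.toClass_eq (.theta_comp_mu p.2.1.dec (thetaU e p) q₁.dec q₂.1.dec) }

/-! ### Transport of arrow terms along the encoding, and coherence -/

/-- An arrow term, with its type written as that of an arrow term of labelled expressions. -/
def ArrowU.recode {G : Type u} {α : G → ℕ} {f g : TermU G} :
    ArrowU α f g → ArrowU α (dec (enc f)) (dec (enc g))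
  | .id f p => .id _ (legit_enc p).dec
  | .beta h g f p => .beta _ _ _ ⟨(legit_enc p.left).dec, (legit_enc p.right).dec⟩
  | .betaInv h g f p => .betaInv _ _ _ ⟨(legit_enc p.left).dec, (legit_enc p.right).dec⟩
  | .theta h g f p => .theta _ _ _
      ⟨by simpa only [dec_enc] using p.ne, (legit_enc p.left).dec, (legit_enc p.right).dec⟩
  | .mu f a p => .mu _ a (legit_enc p).dec
  | .muInv f a p => .muInv _ a (legit_enc p).dec
  | .lam a f p => .lam a _ (legit_enc p).dec
  | .lamInv a f p => .lamInv a _ (legit_enc p).dec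
  | .comp v u => .comp v.recode u.recode
  | .ins v u p p' => .ins v.recode u.recode (legit_enc p).dec (legit_enc p').dec

/-- The round trip `dec_enc` is not a definitional equality, so the arrow terms are compared
heterogeneously. In each case the round trips are generalized to variables and then identified with
the original terms. -/
theorem ArrowU.recode_heq {G : Type u} {α : G → ℕ} {f g : TermU G} (u : ArrowU α f g) :
    HEq u.recode u := by
  induction u with
  | id f p =>
    have key {f' : TermU G} (hf : f' = f) (p') : HEq (id (α := α) f' p') (id f p) := by
      subst hf; rfl
    exact key (dec_enc f) _
  | beta h g f p =>
    have key {h' g' f' : TermU G} (hh : h' = h) (hg : g' = g) (hf : f' = f) (p') :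
        HEq (beta (α := α) h' g' f' p') (beta h g f p) := by subst hh hg hf; rfl
    exact key (dec_enc h) (dec_enc g) (dec_enc f) _
  | betaInv h g f p =>
    have key {h' g' f' : TermU G} (hh : h' = h) (hg : g' = g) (hf : f' = f) (p') :
        HEq (betaInv (α := α) h' g' f' p') (betaInv h g f p) := by subst hh hg hf; rfl
    exact key (dec_enc h) (dec_enc g) (dec_enc f) _
  | theta h g f p =>
    have key {h' g' f' : TermU G} (hh : h' = h) (hg : g' = g) (hf : f' = f) (p') :
        HEq (theta (α := α) h' g' f' p') (theta h g f p) := by subst hh hg hf; rfl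
    exact key (dec_enc h) (dec_enc g) (dec_enc f) _
  | mu f a p =>
    have key {f' : TermU G} (hf : f' = f) (p') : HEq (mu (α := α) f' a p') (mu f a p) := by
      subst hf; rfl
    exact key (dec_enc f) _
  | muInv f a p =>
    have key {f' : TermU G} (hf : f' = f) (p') :
        HEq (muInv (α := α) f' a p') (muInv f a p) := by subst hf; rfl
    exact key (dec_enc f) _
  | lam a f p =>
    have key {f' : TermU G} (hf : f' = f) (p') : HEq (lam (α := α) a f' p') (lam a f p) := by
      subst hf; rfl
    exact key (dec_enc f) _
  | lamInv a f p =>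
    have key {f' : TermU G} (hf : f' = f) (p') :
        HEq (lamInv (α := α) a f' p') (lamInv a f p) := by subst hf; rfl
    exact key (dec_enc f) _
  | @comp f g h v u ihv ihu =>
    have key {f' g' h' : TermU G} (hf : f' = f) (hg : g' = g) (hh : h' = h)
        {v' : ArrowU α g' h'} {u' : ArrowU α f' g'} (hv : HEq v' v) (hu : HEq u' u) :
        HEq (comp v' u') (comp v u) := by subst hf hg hh hv hu; rfl
    exact key (dec_enc f) (dec_enc g) (dec_enc h) ihv ihu
  | @ins g₁ g₂ f₁ f₂ v u p p' ihv ihu =>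
    have key {g₁' g₂' f₁' f₂' : TermU G} (hg₁ : g₁' = g₁) (hg₂ : g₂' = g₂) (hf₁ : f₁' = f₁)
        (hf₂ : f₂' = f₂) {v' : ArrowU α g₁' g₂'} {u' : ArrowU α f₁' f₂'} (hv : HEq v' v)
        (hu : HEq u' u) (q q') : HEq (ins v' u' q q') (ins v u p p') := by
      subst hg₁ hg₂ hf₁ hf₂ hv hu; rfl
    exact key (dec_enc g₁) (dec_enc g₂) (dec_enc f₁) (dec_enc f₂) ihv ihu _ _

/-- The arrow of an arrow term. -/
def HomU.mk' {G : Type u} {α : G → ℕ} {f g : TermU G} (u : ArrowU α f g) :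
    HomU α (enc f) (enc g) :=
  ⟨⟨fun _ => legit_enc u.legit.2, fun _ => legit_enc u.legit.1⟩, fun _ => u.recode.toClass⟩

theorem Labelled.isUnit_gen {G : Type u} (a : Word) :
    Labelled.IsUnit (.gen (a, none) : Labelled G) :=
  ⟨a, rfl⟩

open InsertionSystem in
theorem ArrowU.reducible {G : Type u} {α : G → ℕ} {f g : TermU G} (u : ArrowU α f g) :
    letI := HomU.insertionSystem α
    Reducible (L := Word × Option G) (x := enc f) (y := enc g) (HomU.mk' u) := by
  let := HomU.insertionSystem α
  induction u with
  | id f p => exact (Path.nil (L := Word × Option G) (enc f)).reducible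
  | beta h g f p =>
    have e : f.t = f.t ∧ g.t <+: f.t := ⟨rfl, p.t_prefix⟩
    exact (Step.beta (L := Word × Option G) e (enc h) (enc g) (enc f)).reducible
  | betaInv h g f p =>
    have e : f.t = f.t ∧ g.t <+: f.t := ⟨rfl, p.t_prefix⟩
    exact (Step.beta (L := Word × Option G) e (enc h) (enc g)
      (enc f)).reducible_inv
  | theta h g f p =>
    exact reducible_theta (L := Word × Option G) p.indep (enc h) (enc g) (enc f)
  | mu f a p =>
    exact (Step.mu (L := Word × Option G) (isUnit_gen a) (legit_enc p)).reducible
  | muInv f a p =>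
    exact (Step.mu (L := Word × Option G) (isUnit_gen a) (legit_enc p)).reducible_inv
  | lam a f p =>
    obtain rfl : f.t = a := p.2.2
    exact (Step.lam (L := Word × Option G) (isUnit_gen f.t) (legit_enc p)).reducible
  | lamInv a f p =>
    obtain rfl : f.t = a := p.2.2
    exact (Step.lam (L := Word × Option G) (isUnit_gen f.t) (legit_enc p)).reducible_inv
  | comp v u ihv ihu => exact Reducible.comp ihu ihv
  | @ins g₁ g₂ f₁ f₂ v u p p' ihv ihu =>
    -- Insertion of arrows keeps the label `f₁.t`, whereas the encoded target carries `f₂.t`. Arrows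
    -- preserve target words, so the two agree.
    have key {b : Word} (hb : f₁.t = b)
        (i : Legit α ((enc g₁).ins f₁.t (enc f₁)) ↔ Legit α ((enc g₂).ins b (enc f₂))) (q q') :
        Reducible (L := Word × Option G) (x := (enc g₁).ins f₁.t (enc f₁))
          (y := (enc g₂).ins b (enc f₂))
          (⟨i, fun _ => (ArrowU.ins v.recode u.recode q q').toClass⟩ : HomU α _ _) := by
      subst hb
      exact Reducible.map f₁.t ihv ihu
    exact key u.t_eq _ _ _

/-- All diagrams of arrow terms of `WOu` commute. -/
theorem ArrowU.equ {G : Type u} {α : G → ℕ} {f g : TermU G} (u v : ArrowU α f g) : Equ u v := by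
  let := HomU.insertionSystem α
  have e := InsertionSystem.Reducible.eq (L := Word × Option G) (legit_enc u.legit.1)
    u.reducible v.reducible
  have h : Equ u.recode v.recode :=
    Quotient.exact (congrFun (congrArg HomU.arr e) (legit_enc u.legit.1))
  -- The equation between the recoded arrow terms is carried back along the round trip.
  have key {f' g' : TermU G} (hf : f' = f) (hg : g' = g) {u' v' : ArrowU α f' g'}
      (hu : HEq u' u) (hv : HEq v' v) (h : Equ u' v') : Equ u v := by
    subst hf hg
    rwa [← eq_of_heq hu, ← eq_of_heq hv]
  exact key (dec_enc f) (dec_enc g) u.recode_heq v.recode_heq h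

end WeakCatOperad

theorem mainTheorem1 {G : Type*} (α : G → ℕ) :
    ((∀ (f g : WeakCatOperad.TermE G) (u v : WeakCatOperad.ArrowE α f g),
        WeakCatOperad.ArrowE.Equ u v) ∧
      Quiver.IsThin (WeakCatOperad.WOe α)) ∧
    ((∀ (f g : WeakCatOperad.TermU G) (u v : WeakCatOperad.ArrowU α f g),
        WeakCatOperad.ArrowU.Equ u v) ∧
      Quiver.IsThin (WeakCatOperad.WOu α)) := by
  refine ⟨⟨fun f g u v => u.equ v, fun f g => ⟨?_⟩⟩, fun f g u v => u.equ v, fun f g => ⟨?_⟩⟩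
  · rintro ⟨u⟩ ⟨v⟩
    exact Quotient.sound (u.equ v)
  · rintro ⟨u⟩ ⟨v⟩
    exact Quotient.sound (u.equ v)
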